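/- Let $\pi:E\to M$ be a smooth fibre bundle with $\dim M=n$ and $k$-dimensional typical fibre, so $\dim E=n+k$. Indices $i,j$ run over $1,\dots,n$ and $A,B$ over $1,\dots,k$. An adapted frame at $e\in E$ is a basis $(e_i,e_A)$ of $T_eE$ with $\pi_*(e)(e_A)=0$ for all $A$; the adapted frames form the adapted frame bundle $L_\pi E\to E$, a principal bundle with structure group $$G_V=\left\{\begin{pmatrix}A&0\\ C&B\end{pmatrix}: A\in GL(n,\mathbb R),\ B\in GL(k,\mathbb R),\ C\in\mathbb R^{k\times n}\right\},\qquad (e_i,e_A)\begin{pmatrix}A&0\\ C&B\end{pmatrix}=(A^i_je_i+C^A_je_A,\ B^A_Be_A).$$ Let $H\cong GL(n,\mathbb R)\times GL(k,\mathbb R)$ be the subgroup $C=0$ of $G_V$. Each coset in $G_V/H$ has a unique representative $\begin{pmatrix}I&0\\ \xi&I\end{pmatrix}$; this identifies $G_V/H$ with $\mathbb R^{kn}$, and gives $G_V/H$ a $G_V$-invariant affine structure modelled on $\mathbb R^{kn}$, on which $G_V$ acts by $\xi\mapsto CA^{-1}+B\xi A^{-1}$. Let $L_\pi E\times_{G_V}(G_V/H)\to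 E$ be the associated bundle, whose points are the classes $[u,x]$ with $[ug,x]=[u,gx]$; its local trivializations are $[s(e),\xi]\mapsto(e,\xi)$ for the smooth local sections $s$ of $L_\pi E$, and its fibre over $e$ carries the affine structure for which $x\mapsto[u,x]$ is affine for every frame $u$ at $e$ (modelled on the fibre of $L_\pi E\times_{G_V}\mathbb R^{kn}$, where $G_V$ acts by $v\mapsto BvA^{-1}$). Let $J^1\pi\to E$ be the bundle whose fibre over $e$ is the set of linear maps $\tau:T_{\pi(e)}M\to T_eE$ with $\pi_*(e)\circ\tau=\mathrm{id}$, an affine space modelled on the linear maps $T_{\pi(e)}M\to\ker\pi_*(e)$, with the smooth structure given by the standard jet coordinates $(x^i,y^A,y^A_i)$ of adapted coordinates $(x^i,y^A)$ on $E$. Theorem. Both $L_\pi E\times_{G_V}(G_V/H)$ and $J^1\pi$ are smooth affine bundles over $E$, and there is an isomorphism of smooth affine bundles over $\mathrm{id}_E$ (a diffeomorphism which restricts to an affine isomorphism on each fibre) $$L_\pi E\times_{G_V}(G_V/H)\;\cong\;J^1\pi$$ which sends the class $[(e_i,e_A)_e,\xi]$, for $\xi=(\xi^A_i)\in\mathbb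 R^{kn}\cong G_V/H$, to the linear map $T_{\pi(e)}M\to T_eE$ determined by $\pi_*(e)(e_i)\mapsto e_i+\xi^A_i\,e_A$ for $i=1,\dots,n$. -/

import Mathlib

open scoped Manifold ContDiff Matrix MatrixGroups
open Bundle

noncomputable section

/-! ### The structure group `G_V`, the subgroup `H` and the homogeneous space `G_V / H` -/

/-- The group `G_V` of nonsingular block lower triangular matrices `[A 0; C B]`,
with `A ∈ GL(n, ℝ)`, `B ∈ GL(k, ℝ)` and `C` an arbitrary `k × n` matrix. -/
def blockLowerTriangular (n k : ℕ) : Subgroup (GL (Fin n ⊕ Fin k) ℝ) where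
  carrier := {g | ∃ (A : GL (Fin n) ℝ) (C : Matrix (Fin k) (Fin n) ℝ) (B : GL (Fin k) ℝ),
    (g : Matrix (Fin n ⊕ Fin k) (Fin n ⊕ Fin k) ℝ) = Matrix.fromBlocks A.1 0 C B.1}
  one_mem' := ⟨1, 0, 1, by simp⟩
  mul_mem' := by
    rintro g g' ⟨A, C, B, h⟩ ⟨A', C', B', h'⟩
    exact ⟨A * A', C * A'.1 + B.1 * C', B * B', by
      simp [h, h', Matrix.fromBlocks_multiply]⟩
  inv_mem' := by
    rintro g ⟨A, C, B, h⟩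
    refine ⟨A⁻¹, -((B⁻¹).1 * C * (A⁻¹).1), B⁻¹, ?_⟩
    have key : Matrix.fromBlocks (A⁻¹).1 0 (-((B⁻¹).1 * C * (A⁻¹).1)) (B⁻¹).1 * g.1 = 1 := by
      rw [h, Matrix.fromBlocks_multiply, ← Matrix.fromBlocks_one]
      congr 1
      · simp
      · simp
      · simp [Matrix.mul_assoc]
      · simp
    exact Units.inv_eq_of_mul_eq_one_left key

/-- `G_V` as a group in its own right. -/
abbrev GV (n k : ℕ) : Type := blockLowerTriangular n k

namespace GV

variable {n k : ℕ}

/-- The block `A` of `[A 0; C B]`. -/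
def A (g : GV n k) : Matrix (Fin n) (Fin n) ℝ := g.1.1.toBlocks₁₁
/-- The block `C` of `[A 0; C B]`. -/
def C (g : GV n k) : Matrix (Fin k) (Fin n) ℝ := g.1.1.toBlocks₂₁
/-- The block `B` of `[A 0; C B]`. -/
def B (g : GV n k) : Matrix (Fin k) (Fin k) ℝ := g.1.1.toBlocks₂₂

theorem val_eq (g : GV n k) : g.1.1 = Matrix.fromBlocks g.A 0 g.C g.B := by
  obtain ⟨A, C, B, h⟩ := g.2
  simp [GV.A, GV.C, GV.B, h]

theorem isUnit_A (g : GV n k) : IsUnit g.A := by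
  obtain ⟨A, C, B, h⟩ := g.2
  simp [GV.A, h]

theorem isUnit_B (g : GV n k) : IsUnit g.B := by
  obtain ⟨A, C, B, h⟩ := g.2
  simp [GV.B, h]

theorem isUnit_det_A (g : GV n k) : IsUnit g.A.det := (Matrix.isUnit_iff_isUnit_det _).1 g.isUnit_A

@[simp] theorem A_one : (1 : GV n k).A = 1 := by
  simp [GV.A, ← Matrix.fromBlocks_one]
@[simp] theorem C_one : (1 : GV n k).C = 0 := by
  simp [GV.C, ← Matrix.fromBlocks_one]
@[simp] theorem B_one : (1 : GV n k).B = 1 := by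
  simp [GV.B, ← Matrix.fromBlocks_one]

theorem val_mul (g h : GV n k) : (g * h).1.1 =
    Matrix.fromBlocks (g.A * h.A) 0 (g.C * h.A + g.B * h.C) (g.B * h.B) := by
  change g.1.1 * h.1.1 = _
  rw [val_eq g, val_eq h, Matrix.fromBlocks_multiply]
  simp

theorem A_mul (g h : GV n k) : (g * h).A = g.A * h.A := by
  rw [GV.A, val_mul, Matrix.toBlocks_fromBlocks₁₁]
theorem C_mul (g h : GV n k) : (g * h).C = g.C * h.A + g.B * h.C := by
  rw [GV.C, val_mul, Matrix.toBlocks_fromBlocks₂₁]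
theorem B_mul (g h : GV n k) : (g * h).B = g.B * h.B := by
  rw [GV.B, val_mul, Matrix.toBlocks_fromBlocks₂₂]

/-- The subgroup `H ≅ GL(n) × GL(k)` of block diagonal matrices in `G_V`. -/
def H (n k : ℕ) : Subgroup (GV n k) where
  carrier := {g | ∃ (A : GL (Fin n) ℝ) (B : GL (Fin k) ℝ),
    (g.1 : Matrix (Fin n ⊕ Fin k) (Fin n ⊕ Fin k) ℝ) = Matrix.fromBlocks A.1 0 0 B.1}
  one_mem' := ⟨1, 1, by simp⟩
  mul_mem' := by
    rintro g g' ⟨A, B, h⟩ ⟨A', B', h'⟩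
    exact ⟨A * A', B * B', by simp [h, h', Matrix.fromBlocks_multiply]⟩
  inv_mem' := by
    rintro g ⟨A, B, h⟩
    refine ⟨A⁻¹, B⁻¹, ?_⟩
    have key : Matrix.fromBlocks (A⁻¹).1 0 0 (B⁻¹).1 * g.1.1 = 1 := by
      rw [h, Matrix.fromBlocks_multiply, ← Matrix.fromBlocks_one]
      simp
    exact Units.inv_eq_of_mul_eq_one_left key

theorem mem_H_iff {g : GV n k} : g ∈ H n k ↔ g.C = 0 := by
  constructor
  · rintro ⟨A, B, h⟩
    simp [GV.C, h]
  · intro h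
    exact ⟨g.isUnit_A.unit, g.isUnit_B.unit, by rw [g.val_eq, h]; rfl⟩

/-- The representative `[I 0; ξ I]` attached to a `k × n` matrix `ξ`. -/
def unip (ξ : Matrix (Fin k) (Fin n) ℝ) : GV n k :=
  ⟨⟨Matrix.fromBlocks 1 0 ξ 1, Matrix.fromBlocks 1 0 (-ξ) 1,
      by simp [Matrix.fromBlocks_multiply], by simp [Matrix.fromBlocks_multiply]⟩,
    1, ξ, 1, by simp⟩

@[simp] theorem A_unip (ξ : Matrix (Fin k) (Fin n) ℝ) : (unip ξ).A = 1 := by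
  simp [unip, GV.A]
@[simp] theorem C_unip (ξ : Matrix (Fin k) (Fin n) ℝ) : (unip ξ).C = ξ := by
  simp [unip, GV.C]
@[simp] theorem B_unip (ξ : Matrix (Fin k) (Fin n) ℝ) : (unip ξ).B = 1 := by
  simp [unip, GV.B]

end GV

/-- The homogeneous space `G_V / H` of left cosets. -/
abbrev HomogeneousSpace (n k : ℕ) : Type := GV n k ⧸ GV.H n k

instance (n k : ℕ) : MulAction (GV n k) (HomogeneousSpace n k) :=
  inferInstanceAs (MulAction (GV n k) (GV n k ⧸ GV.H n k))

namespace HomogeneousSpace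

variable {n k : ℕ}

/-- The identification `G_V / H ≃ ℝ^{kn}`: the coset of `[A 0; C B]` has the unique
representative of the form `[I 0; ξ I]`, namely with `ξ = C A⁻¹`. -/
def coord (n k : ℕ) : HomogeneousSpace n k ≃ Matrix (Fin k) (Fin n) ℝ where
  toFun := Quotient.lift (fun g : GV n k => g.C * g.A⁻¹) (by
    intro a b hab
    have hH : a⁻¹ * b ∈ GV.H n k := QuotientGroup.leftRel_apply.1 hab
    obtain ⟨h, rfl⟩ : ∃ h, b = a * h := ⟨a⁻¹ * b, by group⟩
    rw [inv_mul_cancel_left, GV.mem_H_iff] at hH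
    simp only [GV.C_mul, GV.A_mul, hH, Matrix.mul_zero, add_zero, Matrix.mul_inv_rev]
    rw [← Matrix.mul_assoc, Matrix.mul_nonsing_inv_cancel_right _ _ h.isUnit_det_A])
  invFun ξ := (GV.unip ξ : GV n k)
  left_inv := by
    intro x
    induction x using Quotient.inductionOn with
    | h g =>
      refine (QuotientGroup.eq (s := GV.H n k)).2 ?_
      rw [GV.mem_H_iff]
      set ξ := g.C * g.A⁻¹ with hξ
      have h1 : GV.unip ξ * ((GV.unip ξ)⁻¹ * g) = g := by group
      have h2 := congrArg GV.C h1
      have h3 := congrArg GV.A h1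
      rw [GV.C_mul, GV.C_unip, GV.B_unip, Matrix.one_mul] at h2
      rw [GV.A_mul, GV.A_unip, Matrix.one_mul] at h3
      rw [h3, hξ, Matrix.mul_assoc, Matrix.nonsing_inv_mul _ g.isUnit_det_A, Matrix.mul_one] at h2
      simpa using h2
  right_inv ξ := by
    change (GV.unip ξ).C * (GV.unip ξ).A⁻¹ = ξ
    simp

@[simp] theorem coord_mk (g : GV n k) : coord n k (g : HomogeneousSpace n k) = g.C * g.A⁻¹ := rfl

@[simp] theorem coord_symm (ξ : Matrix (Fin k) (Fin n) ℝ) :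
    (coord n k).symm ξ = (GV.unip ξ : HomogeneousSpace n k) := rfl

/-- The left action is `g • (a H) = (g a) H`. -/
theorem smul_mk (g a : GV n k) :
    g • (a : HomogeneousSpace n k) = ((g * a : GV n k) : HomogeneousSpace n k) := rfl

/-- The left action of `G_V` on `G_V / H` reads `ξ ↦ C A⁻¹ + B ξ A⁻¹`. -/
theorem coord_smul (g : GV n k) (x : HomogeneousSpace n k) :
    coord n k (g • x) = g.C * g.A⁻¹ + g.B * coord n k x * g.A⁻¹ := by
  induction x using Quotient.inductionOn with
  | h a =>
    change coord n k ((g * a : GV n k) : HomogeneousSpace n k) = _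
    change _ = g.C * g.A⁻¹ + g.B * (a.C * a.A⁻¹) * g.A⁻¹
    rw [coord_mk, GV.C_mul, GV.A_mul, Matrix.mul_inv_rev, Matrix.add_mul, ← Matrix.mul_assoc,
      ← Matrix.mul_assoc, Matrix.mul_nonsing_inv_cancel_right _ _ a.isUnit_det_A]
    simp only [Matrix.mul_assoc]

/-- The affine structure of `G_V / H`, modelled on `ℝ^{kn}`, obtained from the identification
`G_V / H ≃ ℝ^{kn}`. -/
instance : AddTorsor (Matrix (Fin k) (Fin n) ℝ) (HomogeneousSpace n k) where
  vadd v x := (coord n k).symm (v + coord n k x)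
  zero_vadd x := by
    change (coord n k).symm (0 + coord n k x) = x
    rw [zero_add, Equiv.symm_apply_apply]
  add_vadd v w x := by
    change (coord n k).symm (v + w + coord n k x)
      = (coord n k).symm (v + coord n k ((coord n k).symm (w + coord n k x)))
    rw [Equiv.apply_symm_apply, add_assoc]
  vsub x y := coord n k x - coord n k y
  nonempty := ⟨(1 : GV n k)⟩
  vsub_vadd' x y := by
    change (coord n k).symm (coord n k x - coord n k y + coord n k y) = x
    rw [sub_add_cancel, Equiv.symm_apply_apply]
  vadd_vsub' v x := by
    change coord n k ((coord n k).symm (v + coord n k x)) - coord n k x = v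
    rw [Equiv.apply_symm_apply, add_sub_cancel_right]

theorem coord_vadd (v : Matrix (Fin k) (Fin n) ℝ) (x : HomogeneousSpace n k) :
    coord n k (v +ᵥ x) = v + coord n k x := (coord n k).apply_symm_apply _

theorem vsub_eq (x y : HomogeneousSpace n k) : x -ᵥ y = coord n k x - coord n k y := rfl

end HomogeneousSpace

/-- The linear action `v ↦ B v A⁻¹` of `G_V` on `ℝ^{kn}`, the linear part of its action
on `G_V / H`. -/
instance GV.linearAction {n k : ℕ} : DistribMulAction (GV n k) (Matrix (Fin k) (Fin n) ℝ) where
  smul g v := g.B * v * g.A⁻¹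
  one_smul v := by
    change (1 : GV n k).B * v * (1 : GV n k).A⁻¹ = v
    simp
  mul_smul g h v := by
    change (g * h).B * v * (g * h).A⁻¹ = g.B * (h.B * v * h.A⁻¹) * g.A⁻¹
    rw [GV.B_mul, GV.A_mul, Matrix.mul_inv_rev]
    simp only [Matrix.mul_assoc]
  smul_zero g := by
    change g.B * 0 * g.A⁻¹ = 0
    simp
  smul_add g v w := by
    change g.B * (v + w) * g.A⁻¹ = g.B * v * g.A⁻¹ + g.B * w * g.A⁻¹
    rw [Matrix.mul_add, Matrix.add_mul]

theorem GV.linear_smul_def {n k : ℕ} (g : GV n k) (v : Matrix (Fin k) (Fin n) ℝ) :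
    g • v = g.B * v * g.A⁻¹ := rfl

/-- The affine structure of `G_V / H` is `G_V`-invariant. -/
theorem HomogeneousSpace.smul_vadd {n k : ℕ} (g : GV n k) (v : Matrix (Fin k) (Fin n) ℝ)
    (x : HomogeneousSpace n k) : g • (v +ᵥ x) = (g • v) +ᵥ (g • x) := by
  apply (HomogeneousSpace.coord n k).injective
  rw [coord_smul, coord_vadd, coord_vadd, coord_smul, GV.linear_smul_def, Matrix.mul_add,
    Matrix.add_mul]
  abel

theorem GV.linear_smul_smul {n k : ℕ} (g : GV n k) (c : ℝ) (v : Matrix (Fin k) (Fin n) ℝ) :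
    g • (c • v) = c • (g • v) := by
  simp [GV.linear_smul_def]

/-! ### Smooth fibre bundles and adapted charts -/

section Bundles

variable {n k : ℕ} {M E F : Type*}
  [TopologicalSpace M] [ChartedSpace (EuclideanSpace ℝ (Fin n)) M]
  [TopologicalSpace E] [ChartedSpace (EuclideanSpace ℝ (Fin (n + k))) E]
  [TopologicalSpace F] [ChartedSpace (EuclideanSpace ℝ (Fin k)) F]

/-- A smooth fibre bundle `π : E → M` with typical fibre `F`, where `dim M = n`, `dim F = k`
and `dim E = n + k`. -/
structure SmoothFiberBundle (n k : ℕ) (M E F : Type*)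
    [TopologicalSpace M] [ChartedSpace (EuclideanSpace ℝ (Fin n)) M]
    [TopologicalSpace E] [ChartedSpace (EuclideanSpace ℝ (Fin (n + k))) E]
    [TopologicalSpace F] [ChartedSpace (EuclideanSpace ℝ (Fin k)) F] where
  /-- The projection of the bundle. -/
  proj : E → M
  /-- Around every point of the base there is a smooth local trivialization
  `π⁻¹(U) ≅ U × F` over `U`. -/
  exists_trivialization (x : M) : ∃ t : Bundle.Trivialization F proj, x ∈ t.baseSet ∧
    ContMDiffOn (𝓡 (n + k)) ((𝓡 n).prod (𝓡 k)) ∞ t t.source ∧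
    ContMDiffOn ((𝓡 n).prod (𝓡 k)) (𝓡 (n + k)) ∞ t.toOpenPartialHomeomorph.symm t.target

set_option linter.unusedSectionVars false

namespace SmoothFiberBundle

variable (p : SmoothFiberBundle n k M E F)

/-- The tangent map `π_*(e) : T_e E → T_{π(e)} M`. -/
abbrev tangentMapAt (e : E) :
    TangentSpace (𝓡 (n + k)) e →L[ℝ] TangentSpace (𝓡 n) (p.proj e) :=
  mfderiv (𝓡 (n + k)) (𝓡 n) p.proj e

/-- Adapted coordinates `(x^i, y^A)` on an open subset of `E`: a smooth chart `(x, y)` of `E`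
together with a smooth chart of `M` in which `π` reads `(x, y) ↦ x`. -/
structure AdaptedChart where
  /-- The chart `(x, y)` of the total space. -/
  total : OpenPartialHomeomorph E (EuclideanSpace ℝ (Fin n) × EuclideanSpace ℝ (Fin k))
  /-- The chart `x` of the base. -/
  base : OpenPartialHomeomorph M (EuclideanSpace ℝ (Fin n))
  contMDiffOn_total : ContMDiffOn (𝓡 (n + k))
    𝓘(ℝ, EuclideanSpace ℝ (Fin n) × EuclideanSpace ℝ (Fin k)) ∞ total total.source
  contMDiffOn_total_symm :
    ContMDiffOn 𝓘(ℝ, EuclideanSpace ℝ (Fin n) × EuclideanSpace ℝ (Fin k)) (𝓡 (n + k)) ∞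
      total.symm total.target
  contMDiffOn_base : ContMDiffOn (𝓡 n) (𝓡 n) ∞ base base.source
  contMDiffOn_base_symm : ContMDiffOn (𝓡 n) (𝓡 n) ∞ base.symm base.target
  mapsTo_proj : Set.MapsTo p.proj total.source base.source
  base_proj : ∀ e ∈ total.source, base (p.proj e) = (total e).1

theorem exists_adaptedChart [IsManifold (𝓡 n) ∞ M] [IsManifold (𝓡 k) ∞ F] (e : E) :
    ∃ c : p.AdaptedChart, e ∈ c.total.source := by
  obtain ⟨t, hx, ht, ht'⟩ := p.exists_trivialization (p.proj e)
  have he : e ∈ t.source := t.mem_source.2 hx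
  let b := chartAt (EuclideanSpace ℝ (Fin n)) (p.proj e)
  let f := chartAt (EuclideanSpace ℝ (Fin k)) (t e).2
  have hb : ContMDiffOn (𝓡 n) (𝓡 n) ∞ b b.source := contMDiffOn_chart
  have hf : ContMDiffOn (𝓡 k) (𝓡 k) ∞ f f.source := contMDiffOn_chart
  have hb' : ContMDiffOn (𝓡 n) (𝓡 n) ∞ b.symm b.target := contMDiffOn_chart_symm
  have hf' : ContMDiffOn (𝓡 k) (𝓡 k) ∞ f.symm f.target := contMDiffOn_chart_symm
  have hsrc : ∀ e' ∈ (t.toOpenPartialHomeomorph.trans (b.prod f)).source,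
      e' ∈ t.source ∧ p.proj e' ∈ b.source ∧ (t e').2 ∈ f.source := by
    intro e' he'
    have h1 : e' ∈ t.source := he'.1
    have h2 : t e' ∈ b.source ×ˢ f.source := he'.2
    refine ⟨h1, ?_, h2.2⟩
    rw [← t.coe_fst h1]
    exact h2.1
  refine ⟨⟨t.toOpenPartialHomeomorph.trans (b.prod f), b, ?_, ?_, hb, hb', ?_, ?_⟩, ?_⟩
  · have h := ContMDiffOn.comp (t := b.source ×ˢ f.source) (s := (t.toOpenPartialHomeomorph.trans
      (b.prod f)).source) (hb.prodMap hf) (ht.mono fun e' he' => (hsrc e' he').1)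
      (fun e' he' => he'.2)
    rw [modelWithCornersSelf_prod, ← chartedSpaceSelf_prod]
    exact h
  · have h := ContMDiffOn.comp (t := t.target) (s := (t.toOpenPartialHomeomorph.trans
      (b.prod f)).target) ht' ((hb'.prodMap hf').mono fun q hq => hq.1) (fun q hq => hq.2)
    rw [modelWithCornersSelf_prod, ← chartedSpaceSelf_prod]
    exact h
  · intro e' he'
    exact (hsrc e' he').2.1
  · intro e' he'
    change b (p.proj e') = b (t e').1
    rw [t.coe_fst (hsrc e' he').1]
  · refine ⟨he, ?_⟩
    change t e ∈ b.source ×ˢ f.source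
    refine ⟨?_, mem_chart_source _ _⟩
    rw [t.coe_fst he]
    exact mem_chart_source _ _

namespace AdaptedChart

variable {p} (c : p.AdaptedChart)

/-- The standard basis of `ℝ^n × ℝ^k`. -/
def stdBasis (n k : ℕ) :
    Module.Basis (Fin n ⊕ Fin k) ℝ (EuclideanSpace ℝ (Fin n) × EuclideanSpace ℝ (Fin k)) :=
  (EuclideanSpace.basisFun (Fin n) ℝ).toBasis.prod (EuclideanSpace.basisFun (Fin k) ℝ).toBasis

/-- The coordinate vector fields `∂/∂x^i` and `∂/∂y^A` of an adapted chart. -/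
def coordVec (α : Fin n ⊕ Fin k) (e : E) : TangentSpace (𝓡 (n + k)) e :=
  mfderiv 𝓘(ℝ, EuclideanSpace ℝ (Fin n) × EuclideanSpace ℝ (Fin k)) (𝓡 (n + k)) c.total.symm
    (c.total e) (stdBasis n k α)

end AdaptedChart

/-- An adapted frame `(e_i, e_A)` at `e ∈ E`: a basis of `T_e E` whose last `k` vectors are
vertical. -/
@[ext]
structure AdaptedFrame (e : E) where
  /-- The underlying basis; `inl i` stands for the index `i` and `inr A` for the index `A`. -/
  basis : Module.Basis (Fin n ⊕ Fin k) ℝ (TangentSpace (𝓡 (n + k)) e)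
  vertical : ∀ A : Fin k, p.tangentMapAt e (basis (Sum.inr A)) = 0

/-- A smooth local section `e ↦ (e_i, e_A)_e` of the adapted frame bundle over an open set. -/
structure LocalAdaptedFrame [IsManifold (𝓡 (n + k)) ∞ E] where
  /-- The vector fields making up the frame. -/
  vec : Fin n ⊕ Fin k → (e : E) → TangentSpace (𝓡 (n + k)) e
  /-- The domain of the section. -/
  domain : Set E
  isOpen_domain : IsOpen domain
  isLocalFrameOn :
    IsLocalFrameOn (𝓡 (n + k)) (EuclideanSpace ℝ (Fin (n + k))) ∞ vec domain
  vertical : ∀ e ∈ domain, ∀ A : Fin k, p.tangentMapAt e (vec (Sum.inr A) e) = 0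

namespace AdaptedChart

variable {p} (c : p.AdaptedChart)

theorem mdifferentiable : c.total.MDifferentiable (𝓡 (n + k))
    𝓘(ℝ, EuclideanSpace ℝ (Fin n) × EuclideanSpace ℝ (Fin k)) :=
  ⟨c.contMDiffOn_total.mdifferentiableOn (by simp),
    c.contMDiffOn_total_symm.mdifferentiableOn (by simp)⟩

/-- The basis of `T_e E` formed by the coordinate vectors of an adapted chart. -/
def coordBasis {e : E} (he : e ∈ c.total.source) :
    Module.Basis (Fin n ⊕ Fin k) ℝ (TangentSpace (𝓡 (n + k)) e) :=
  (stdBasis n k).map (c.mdifferentiable.mfderiv he).symm.toLinearEquiv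

theorem coordBasis_apply {e : E} (he : e ∈ c.total.source) (α : Fin n ⊕ Fin k) :
    c.coordBasis he α = c.coordVec α e := rfl

theorem proj_symm {q : EuclideanSpace ℝ (Fin n) × EuclideanSpace ℝ (Fin k)}
    (hq : q ∈ c.total.target) : p.proj (c.total.symm q) = c.base.symm q.1 := by
  have h := c.base_proj _ (c.total.map_target hq)
  rw [c.total.right_inv hq] at h
  rw [← h, c.base.left_inv (c.mapsTo_proj (c.total.map_target hq))]

theorem hasMFDerivAt_proj {e : E} (he : e ∈ c.total.source) :
    HasMFDerivAt (𝓡 (n + k)) (𝓡 n) p.proj e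
      (((mfderiv (𝓡 n) (𝓡 n) c.base.symm (c.total e).1).comp
        (ContinuousLinearMap.fst ℝ (EuclideanSpace ℝ (Fin n)) (EuclideanSpace ℝ (Fin k)))).comp
        (mfderiv (𝓡 (n + k)) 𝓘(ℝ, EuclideanSpace ℝ (Fin n) × EuclideanSpace ℝ (Fin k))
          c.total e)) := by
  have h1 : HasMFDerivAt (𝓡 (n + k)) 𝓘(ℝ, EuclideanSpace ℝ (Fin n) × EuclideanSpace ℝ (Fin k))
      c.total e (mfderiv (𝓡 (n + k)) 𝓘(ℝ, EuclideanSpace ℝ (Fin n) × EuclideanSpace ℝ (Fin k))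
          c.total e) :=
    ((c.contMDiffOn_total.contMDiffAt (c.total.open_source.mem_nhds he)).mdifferentiableAt
      (by simp)).hasMFDerivAt
  have h2 : HasMFDerivAt 𝓘(ℝ, EuclideanSpace ℝ (Fin n) × EuclideanSpace ℝ (Fin k)) (𝓡 n)
      (Prod.fst : EuclideanSpace ℝ (Fin n) × EuclideanSpace ℝ (Fin k) → _) (c.total e)
      (ContinuousLinearMap.fst ℝ (EuclideanSpace ℝ (Fin n)) (EuclideanSpace ℝ (Fin k))) :=
    (ContinuousLinearMap.fst ℝ (EuclideanSpace ℝ (Fin n)) (EuclideanSpace ℝ (Fin k))).hasMFDerivAt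
  have hb : (c.total e).1 ∈ c.base.target := by
    rw [← c.base_proj e he]
    exact c.base.map_source (c.mapsTo_proj he)
  have h3 : HasMFDerivAt (𝓡 n) (𝓡 n) c.base.symm (c.total e).1
      (mfderiv (𝓡 n) (𝓡 n) c.base.symm (c.total e).1) :=
    ((c.contMDiffOn_base_symm.contMDiffAt (c.base.open_target.mem_nhds hb)).mdifferentiableAt
      (by simp)).hasMFDerivAt
  refine ((h3.comp (c.total e) h2).comp e h1).congr_of_eventuallyEq ?_
  filter_upwards [c.total.open_source.mem_nhds he] with e' he'
  have := c.proj_symm (c.total.map_source he')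
  rw [c.total.left_inv he'] at this
  exact this

theorem tangentMapAt_symm {e : E} (he : e ∈ c.total.source)
    (v : EuclideanSpace ℝ (Fin n) × EuclideanSpace ℝ (Fin k)) :
    p.tangentMapAt e ((c.mdifferentiable.mfderiv he).symm v) =
    mfderiv (𝓡 n) (𝓡 n) c.base.symm (c.total e).1 v.1 := by
  have h : mfderiv (𝓡 (n + k)) 𝓘(ℝ, EuclideanSpace ℝ (Fin n) × EuclideanSpace ℝ (Fin k))
      c.total e ((c.mdifferentiable.mfderiv he).symm v) = v :=
    (c.mdifferentiable.mfderiv he).apply_symm_apply v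
  rw [tangentMapAt, (c.hasMFDerivAt_proj he).mfderiv]
  exact congrArg (fun w => mfderiv (𝓡 n) (𝓡 n) c.base.symm (c.total e).1
    (ContinuousLinearMap.fst ℝ (EuclideanSpace ℝ (Fin n)) (EuclideanSpace ℝ (Fin k)) w)) h

theorem tangentMapAt_coordVec_inr {e : E} (he : e ∈ c.total.source) (A : Fin k) :
    p.tangentMapAt e (c.coordVec (Sum.inr A) e) = 0 := by
  refine (c.tangentMapAt_symm he (stdBasis n k (Sum.inr A))).trans ?_
  have : (stdBasis n k (Sum.inr A)).1 = 0 := by simp [stdBasis]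
  exact (congrArg _ this).trans (map_zero _)

theorem surjective_tangentMapAt {e : E} (he : e ∈ c.total.source) :
    Function.Surjective (p.tangentMapAt e) := by
  have hb : (c.total e).1 ∈ c.base.target := by
    rw [← c.base_proj e he]
    exact c.base.map_source (c.mapsTo_proj he)
  have hB : c.base.symm.MDifferentiable (𝓡 n) (𝓡 n) :=
    ⟨c.contMDiffOn_base_symm.mdifferentiableOn (by simp),
      c.contMDiffOn_base.mdifferentiableOn (by simp)⟩
  intro w
  obtain ⟨v, hv⟩ := (hB.mfderiv hb).surjective w
  exact ⟨(c.mdifferentiable.mfderiv he).symm (v, (0 : EuclideanSpace ℝ (Fin k))),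
    (c.tangentMapAt_symm he _).trans hv⟩

theorem contMDiffOn_coordVec [IsManifold (𝓡 (n + k)) ∞ E] (α : Fin n ⊕ Fin k) :
    ContMDiffOn (𝓡 (n + k)) ((𝓡 (n + k)).prod 𝓘(ℝ, EuclideanSpace ℝ (Fin (n + k)))) ∞
      (fun e => (⟨e, c.coordVec α e⟩ : TangentBundle (𝓡 (n + k)) E)) c.total.source := by
  have h := c.contMDiffOn_total_symm.contMDiffOn_tangentMapWithin (m := ∞) (by simp)
    c.total.open_target.uniqueMDiffOn
  have h2 : ContMDiffOn (𝓡 (n + k))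
      (𝓘(ℝ, EuclideanSpace ℝ (Fin n) × EuclideanSpace ℝ (Fin k)).tangent) ∞
      (fun e => (⟨c.total e, stdBasis n k α⟩ :
        TangentBundle 𝓘(ℝ, EuclideanSpace ℝ (Fin n) × EuclideanSpace ℝ (Fin k))
        (EuclideanSpace ℝ (Fin n) × EuclideanSpace ℝ (Fin k)))) c.total.source :=
    (contMDiff_vectorSpace_iff_contDiff (V := fun _ => stdBasis n k α) |>.2
      contDiff_const).comp_contMDiffOn c.contMDiffOn_total
  refine (h.comp h2 ?_).congr ?_
  · intro e he
    exact c.total.map_source he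
  · intro e he
    refine Bundle.TotalSpace.ext (c.total.left_inv he).symm (heq_of_eq ?_)
    have := mfderivWithin_of_isOpen (f := c.total.symm) (I := 𝓘(ℝ, EuclideanSpace ℝ (Fin n) × EuclideanSpace ℝ (Fin k))) (I' := 𝓡 (n + k)) c.total.open_target (c.total.map_source he)
    exact (DFunLike.congr_fun this (stdBasis n k α)).symm

/-- The coordinate frame `(∂/∂x^i, ∂/∂y^A)` of an adapted chart. -/
def frame [IsManifold (𝓡 n) ∞ M] [IsManifold (𝓡 (n + k)) ∞ E] :
    p.LocalAdaptedFrame where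
  vec := c.coordVec
  domain := c.total.source
  isOpen_domain := c.total.open_source
  isLocalFrameOn :=
    { linearIndependent := fun he => (c.coordBasis he).linearIndependent
      generating := fun he => (c.coordBasis he).span_eq.ge
      contMDiffOn := c.contMDiffOn_coordVec }
  vertical _ he A := c.tangentMapAt_coordVec_inr he A

end AdaptedChart

theorem surjective_tangentMapAt [IsManifold (𝓡 n) ∞ M] [IsManifold (𝓡 k) ∞ F] (e : E) :
    Function.Surjective (p.tangentMapAt e) := by
  obtain ⟨c, hc⟩ := p.exists_adaptedChart e
  exact c.surjective_tangentMapAt hc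

/-! ### The adapted frame bundle and its structure group -/

namespace AdaptedFrame

variable {p} {e : E}

instance [IsManifold (𝓡 n) ∞ M] [IsManifold (𝓡 k) ∞ F] : Nonempty (p.AdaptedFrame e) := by
  obtain ⟨c, hc⟩ := p.exists_adaptedChart e
  exact ⟨⟨c.coordBasis hc, fun A => c.tangentMapAt_coordVec_inr hc A⟩⟩

/-- The right action of `G_V` on adapted frames,
`(e_i, e_A) · [A 0; C B] = (A^i_j e_i + C^A_j e_A, B^A_B e_A)`. -/
def act (u : p.AdaptedFrame e) (g : GV n k) : p.AdaptedFrame e where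
  basis := u.basis.map (Matrix.toLinearEquiv u.basis g.1.1
    ((Matrix.isUnit_iff_isUnit_det _).1 g.1.isUnit))
  vertical A := by
    rw [Module.Basis.map_apply, Matrix.toLinearEquiv_apply, Matrix.toLin_self, g.val_eq, map_sum]
    refine Finset.sum_eq_zero fun α _ => ?_
    cases α with
    | inl i => simp
    | inr B => rw [map_smul, u.vertical, smul_zero]

theorem act_basis (u : p.AdaptedFrame e) (g : GV n k) (β : Fin n ⊕ Fin k) :
    (u.act g).basis β = ∑ α, g.1.1 α β • u.basis α := by
  rw [act, Module.Basis.map_apply, Matrix.toLinearEquiv_apply, Matrix.toLin_self]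

theorem act_basis_inl (u : p.AdaptedFrame e) (g : GV n k) (j : Fin n) :
    (u.act g).basis (Sum.inl j) =
      ∑ i, g.A i j • u.basis (Sum.inl i) + ∑ A, g.C A j • u.basis (Sum.inr A) := by
  rw [act_basis, Fintype.sum_sum_type, g.val_eq]
  rfl

theorem act_basis_inr (u : p.AdaptedFrame e) (g : GV n k) (B : Fin k) :
    (u.act g).basis (Sum.inr B) = ∑ A, g.B A B • u.basis (Sum.inr A) := by
  rw [act_basis, Fintype.sum_sum_type, g.val_eq]
  simp

theorem ext_basis {u u' : p.AdaptedFrame e} (h : ∀ α, u.basis α = u'.basis α) : u = u' :=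
  AdaptedFrame.ext (Module.Basis.eq_of_apply_eq h)

@[simp] theorem act_one (u : p.AdaptedFrame e) : u.act 1 = u := by
  refine ext_basis fun β => ?_
  rw [act_basis]
  change ∑ α, (1 : Matrix (Fin n ⊕ Fin k) (Fin n ⊕ Fin k) ℝ) α β • u.basis α = _
  simp [Matrix.one_apply]

theorem act_mul (u : p.AdaptedFrame e) (g h : GV n k) : u.act (g * h) = (u.act g).act h := by
  refine ext_basis fun β => ?_
  rw [act_basis, act_basis]
  simp only [act_basis, Finset.smul_sum, smul_smul]
  change ∑ α, (g.1.1 * h.1.1) α β • u.basis α = _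
  simp only [Matrix.mul_apply, Finset.sum_smul]
  rw [Finset.sum_comm]
  simp only [mul_comm]

theorem act_injective (u : p.AdaptedFrame e) : Function.Injective u.act := by
  intro g h hgh
  refine Subtype.ext (Units.ext ?_)
  ext α β
  have h1 := congrArg (fun v : p.AdaptedFrame e => u.basis.repr (v.basis β) α) hgh
  simpa [act_basis, Finsupp.single_apply, -Fintype.sum_sum_type] using h1

variable [IsManifold (𝓡 n) ∞ M] [IsManifold (𝓡 k) ∞ F]

/-- The basis `ê_i = π_*(e)(e_i)` of `T_{π(e)} M` induced by an adapted frame. -/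
def baseBasis (u : p.AdaptedFrame e) :
    Module.Basis (Fin n) ℝ (TangentSpace (𝓡 n) (p.proj e)) :=
  basisOfTopLeSpanOfCardEqFinrank (fun i => p.tangentMapAt e (u.basis (Sum.inl i)))
    (by
      intro w _
      obtain ⟨v, rfl⟩ := p.surjective_tangentMapAt e w
      rw [← u.basis.sum_repr v, map_sum, Fintype.sum_sum_type]
      simp only [map_smul, u.vertical, smul_zero, Finset.sum_const_zero, add_zero]
      exact Submodule.sum_mem _ fun i _ =>
        Submodule.smul_mem _ _ (Submodule.subset_span ⟨i, rfl⟩))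
    (by
      rw [Fintype.card_fin]
      exact (finrank_euclideanSpace_fin (𝕜 := ℝ) (n := n)).symm)

@[simp] theorem baseBasis_apply (u : p.AdaptedFrame e) (i : Fin n) :
    u.baseBasis i = p.tangentMapAt e (u.basis (Sum.inl i)) := by
  simp [baseBasis]

theorem baseBasis_repr (u : p.AdaptedFrame e) (v : TangentSpace (𝓡 (n + k)) e) (i : Fin n) :
    u.baseBasis.repr (p.tangentMapAt e v) i = u.basis.repr v (Sum.inl i) := by
  conv_lhs => rw [← u.basis.sum_repr v]
  rw [map_sum, Fintype.sum_sum_type]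
  simp only [map_smul, u.vertical, smul_zero, Finset.sum_const_zero, add_zero, ← baseBasis_apply]
  simp [Finsupp.single_apply, -baseBasis_apply]

/-- `G_V` acts transitively on the adapted frames at a point. -/
theorem exists_act_eq (u u' : p.AdaptedFrame e) : ∃ g : GV n k, u' = u.act g := by
  let T := u.basis.toMatrix u'.basis
  let T' := u'.basis.toMatrix u.basis
  have h1 : T * T' = 1 := Module.Basis.toMatrix_mul_toMatrix_flip _ _
  have h2 : T' * T = 1 := Module.Basis.toMatrix_mul_toMatrix_flip _ _
  have h12 : T.toBlocks₁₂ = 0 := by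
    ext i A
    change u.basis.repr (u'.basis (Sum.inr A)) (Sum.inl i) = 0
    rw [← baseBasis_repr, u'.vertical, map_zero]
    rfl
  have hT : T = Matrix.fromBlocks T.toBlocks₁₁ 0 T.toBlocks₂₁ T.toBlocks₂₂ := by
    rw [← h12, Matrix.fromBlocks_toBlocks]
  have hdet : IsUnit (T.toBlocks₁₁.det * T.toBlocks₂₂.det) := by
    rw [← Matrix.det_fromBlocks_zero₁₂, ← hT]
    exact (Matrix.isUnit_iff_isUnit_det _).1 ⟨⟨T, T', h1, h2⟩, rfl⟩
  obtain ⟨hA, hB⟩ := IsUnit.mul_iff.1 hdet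
  refine ⟨⟨⟨T, T', h1, h2⟩, ((Matrix.isUnit_iff_isUnit_det _).2 hA).unit, T.toBlocks₂₁,
    ((Matrix.isUnit_iff_isUnit_det _).2 hB).unit, hT⟩, ?_⟩
  refine ext_basis fun β => ?_
  rw [act_basis]
  exact (u.basis.sum_toMatrix_smul_self u'.basis β).symm

end AdaptedFrame

/-! ### Fibres of associated bundles -/

/-- The equivalence relation `(u, x) ∼ (u g, g⁻¹ x)` on `(L_π E)_e × X`, for a left
`G_V`-space `X`. -/
def associatedSetoid (e : E) (X : Type*) [MulAction (GV n k) X] :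
    Setoid (p.AdaptedFrame e × X) where
  r a b := ∃ g : GV n k, b.1 = a.1.act g ∧ b.2 = g⁻¹ • a.2
  iseqv :=
    { refl := fun a => ⟨1, by simp, by simp⟩
      symm := by
        rintro a b ⟨g, h1, h2⟩
        exact ⟨g⁻¹, by rw [h1, ← AdaptedFrame.act_mul, mul_inv_cancel, AdaptedFrame.act_one],
          by rw [h2, inv_inv, smul_inv_smul]⟩
      trans := by
        rintro a b c ⟨g, h1, h2⟩ ⟨h, h3, h4⟩
        exact ⟨g * h, by rw [h3, h1, AdaptedFrame.act_mul], by rw [h4, h2, mul_inv_rev, mul_smul]⟩ }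

/-- The fibre at `e` of the associated bundle `L_π E ×_{G_V} X`. -/
def Associated (e : E) (X : Type*) [MulAction (GV n k) X] : Type _ :=
  Quotient (p.associatedSetoid e X)

namespace Associated

variable {p} {e : E} {X : Type*} [MulAction (GV n k) X]

/-- The class `[u, x]`. -/
def mk (u : p.AdaptedFrame e) (x : X) : p.Associated e X :=
  Quotient.mk (p.associatedSetoid e X) (u, x)

theorem mk_act (u : p.AdaptedFrame e) (g : GV n k) (x : X) :
    mk (u.act g) x = mk u (g • x) :=
  (Quotient.sound (s := p.associatedSetoid e X) ⟨g, rfl, (inv_smul_smul g x).symm⟩).symm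

variable [IsManifold (𝓡 n) ∞ M] [IsManifold (𝓡 k) ∞ F]

theorem mk_bijective (u : p.AdaptedFrame e) :
    Function.Bijective (mk u : X → p.Associated e X) := by
  constructor
  · intro x y hxy
    obtain ⟨g, h1, h2⟩ := Quotient.exact (s := p.associatedSetoid e X) hxy
    have : g = 1 := u.act_injective (by rw [← h1, AdaptedFrame.act_one])
    rw [this] at h2
    simpa using h2.symm
  · intro a
    induction a using Quotient.inductionOn with
    | h a =>
      obtain ⟨g, hg⟩ := u.exists_act_eq a.1
      exact ⟨g • a.2, by rw [← mk_act, ← hg]; rfl⟩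

/-- The identification of the fibre of an associated bundle with `X` given by a frame `u`,
`[u, x] ↦ x`. -/
def coord (u : p.AdaptedFrame e) : p.Associated e X ≃ X :=
  (Equiv.ofBijective (mk u) (mk_bijective u)).symm

@[simp] theorem coord_mk (u : p.AdaptedFrame e) (x : X) : coord u (mk u x) = x :=
  (Equiv.ofBijective (mk u) (mk_bijective u)).symm_apply_apply x

@[simp] theorem mk_coord (u : p.AdaptedFrame e) (a : p.Associated e X) : mk u (coord u a) = a :=
  (Equiv.ofBijective (mk u) (mk_bijective u)).apply_symm_apply a

theorem coord_symm (u : p.AdaptedFrame e) (x : X) : (coord u).symm x = mk u x := rfl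

theorem coord_act (u : p.AdaptedFrame e) (g : GV n k) (a : p.Associated e X) :
    coord u a = g • coord (u.act g) a := by
  conv_lhs => rw [← mk_coord (u.act g) a, mk_act, coord_mk]

end Associated

variable [IsManifold (𝓡 n) ∞ M] [IsManifold (𝓡 k) ∞ F]

/-- The fibre at `e` of the vector bundle `L_π E ×_{G_V} ℝ^{kn}`. -/
abbrev AssociatedDirection (e : E) : Type := p.Associated e (Matrix (Fin k) (Fin n) ℝ)

/-- The fibre at `e` of the bundle `L_π E ×_{G_V} (G_V / H)`. -/
abbrev AssociatedHomogeneous (e : E) : Type := p.Associated e (HomogeneousSpace n k)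

/-- The linear structure on the fibres of `L_π E ×_{G_V} ℝ^{kn}`: transported along
`v ↦ [u, v]`, for any frame `u`. -/
instance (e : E) : AddCommGroup (p.AssociatedDirection e) :=
  (Associated.coord (Classical.arbitrary (p.AdaptedFrame e))).addCommGroup

instance (e : E) : Module ℝ (p.AssociatedDirection e) :=
  (Associated.coord (Classical.arbitrary (p.AdaptedFrame e))).module ℝ

/-- The affine structure on the fibres of `L_π E ×_{G_V} (G_V / H)`: transported along
`x ↦ [u, x]`, for any frame `u`. -/
instance (e : E) : AddTorsor (p.AssociatedDirection e) (p.AssociatedHomogeneous e) :=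
  let u := Classical.arbitrary (p.AdaptedFrame e)
  let c : p.AssociatedDirection e ≃ Matrix (Fin k) (Fin n) ℝ := Associated.coord u
  let d : p.AssociatedHomogeneous e ≃ HomogeneousSpace n k := Associated.coord u
  { vadd := fun v x => d.symm (c v +ᵥ d x)
    zero_vadd := fun x => by
      change d.symm (c (c.symm 0) +ᵥ d x) = x
      rw [Equiv.apply_symm_apply, zero_vadd, Equiv.symm_apply_apply]
    add_vadd := fun v w x => by
      change d.symm (c (c.symm (c v + c w)) +ᵥ d x) = d.symm (c v +ᵥ d (d.symm (c w +ᵥ d x)))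
      rw [Equiv.apply_symm_apply, Equiv.apply_symm_apply, add_vadd]
    vsub := fun x y => c.symm (d x -ᵥ d y)
    nonempty := ⟨d.symm (Classical.arbitrary _)⟩
    vsub_vadd' := fun x y => by
      change d.symm (c (c.symm (d x -ᵥ d y)) +ᵥ d y) = x
      rw [Equiv.apply_symm_apply, vsub_vadd, Equiv.symm_apply_apply]
    vadd_vsub' := fun v x => by
      change c.symm (d (d.symm (c v +ᵥ d x)) -ᵥ d x) = v
      rw [Equiv.apply_symm_apply, vadd_vsub, Equiv.symm_apply_apply] }

namespace Associated

variable {p} {e : E}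

/-- Addition in the fibres of `L_π E ×_{G_V} ℝ^{kn}` does not depend on the frame. -/
theorem mk_add (u : p.AdaptedFrame e) (v w : Matrix (Fin k) (Fin n) ℝ) :
    (mk u (v + w) : p.AssociatedDirection e) = mk u v + mk u w := by
  obtain ⟨g, hg⟩ := (Classical.arbitrary (p.AdaptedFrame e)).exists_act_eq u
  rw [hg, mk_act, mk_act, mk_act]
  change _ = (coord (Classical.arbitrary (p.AdaptedFrame e))).symm
    (coord _ (mk _ _) + coord _ (mk _ _))
  rw [coord_mk, coord_mk, coord_symm, smul_add]

/-- Scalar multiplication in the fibres of `L_π E ×_{G_V} ℝ^{kn}` does not depend on the frame. -/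
theorem mk_smul (u : p.AdaptedFrame e) (r : ℝ) (v : Matrix (Fin k) (Fin n) ℝ) :
    (mk u (r • v) : p.AssociatedDirection e) = r • mk u v := by
  obtain ⟨g, hg⟩ := (Classical.arbitrary (p.AdaptedFrame e)).exists_act_eq u
  rw [hg, mk_act, mk_act]
  change _ = (coord (Classical.arbitrary (p.AdaptedFrame e))).symm (r • coord _ (mk _ _))
  rw [coord_mk, coord_symm, GV.linear_smul_smul]

/-- The affine structure of the fibres of `L_π E ×_{G_V} (G_V / H)` does not depend on the
frame. -/
theorem mk_vadd (u : p.AdaptedFrame e) (v : Matrix (Fin k) (Fin n) ℝ) (x : HomogeneousSpace n k) :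
    (mk u (v +ᵥ x) : p.AssociatedHomogeneous e) =
      (mk u v : p.AssociatedDirection e) +ᵥ (mk u x : p.AssociatedHomogeneous e) := by
  obtain ⟨g, hg⟩ := (Classical.arbitrary (p.AdaptedFrame e)).exists_act_eq u
  rw [hg, mk_act, mk_act, mk_act]
  change _ = (coord (Classical.arbitrary (p.AdaptedFrame e))).symm
    (coord _ (mk _ _) +ᵥ coord _ (mk _ _))
  rw [coord_mk, coord_mk, coord_symm, HomogeneousSpace.smul_vadd]

/-- The coordinate `ξ` of the class `[u, ξ]` with respect to a frame `u`. -/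
def matrixCoord (u : p.AdaptedFrame e) : p.AssociatedHomogeneous e ≃ Matrix (Fin k) (Fin n) ℝ :=
  (coord u).trans (HomogeneousSpace.coord n k)

theorem matrixCoord_act (u : p.AdaptedFrame e) (g : GV n k) (a : p.AssociatedHomogeneous e) :
    matrixCoord u a = g.C * g.A⁻¹ + g.B * matrixCoord (u.act g) a * g.A⁻¹ := by
  change HomogeneousSpace.coord n k (coord u a) = _
  rw [coord_act u g, HomogeneousSpace.coord_smul]
  rfl

end Associated

/-! ### First jets -/

/-- The fibre of `J¹π` at `e`: the linear right inverses `τ : T_{π(e)} M → T_e E` of `π_*(e)`. -/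
@[ext]
structure Jet (e : E) where
  /-- The underlying linear map. -/
  toLin : TangentSpace (𝓡 n) (p.proj e) →L[ℝ] TangentSpace (𝓡 (n + k)) e
  tangentMapAt_apply (w : TangentSpace (𝓡 n) (p.proj e)) : p.tangentMapAt e (toLin w) = w

/-- The fibre at `e` of the vector bundle on which `J¹π → E` is modelled: the linear maps
`T_{π(e)} M → T_e E` with vertical values. -/
def JetDirection (e : E) :
    Submodule ℝ (TangentSpace (𝓡 n) (p.proj e) →L[ℝ] TangentSpace (𝓡 (n + k)) e) where
  carrier := {σ | ∀ w, p.tangentMapAt e (σ w) = 0}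
  add_mem' := by
    intro σ σ' h h' w
    change p.tangentMapAt e (σ w + σ' w) = 0
    rw [map_add, h, h', add_zero]
  zero_mem' := fun _ => map_zero _
  smul_mem' := by
    intro c σ h w
    change p.tangentMapAt e (c • σ w) = 0
    rw [map_smul, h, smul_zero]

namespace Jet

variable {p} {e : E}

/-- The jet `τ` with `τ(π_* e_i) = e_i + ξ^A_i e_A`. -/
def ofCoord (u : p.AdaptedFrame e) (ξ : Matrix (Fin k) (Fin n) ℝ) : p.Jet e :=
  haveI : FiniteDimensional ℝ (TangentSpace (𝓡 n) (p.proj e)) :=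
    inferInstanceAs (FiniteDimensional ℝ (EuclideanSpace ℝ (Fin n)))
  haveI : T2Space (TangentSpace (𝓡 n) (p.proj e)) :=
    inferInstanceAs (T2Space (EuclideanSpace ℝ (Fin n)))
  { toLin := LinearMap.toContinuousLinearMap
      (u.baseBasis.constr ℝ fun i => u.basis (Sum.inl i) + ∑ A, ξ A i • u.basis (Sum.inr A))
    tangentMapAt_apply := by
      refine LinearMap.congr_fun (f := (p.tangentMapAt e).toLinearMap ∘ₗ
        (u.baseBasis.constr ℝ fun i => u.basis (Sum.inl i) + ∑ A, ξ A i • u.basis (Sum.inr A)))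
        (g := LinearMap.id) (u.baseBasis.ext fun i => ?_)
      change p.tangentMapAt e (u.baseBasis.constr ℝ
        (fun i => u.basis (Sum.inl i) + ∑ A, ξ A i • u.basis (Sum.inr A)) (u.baseBasis i)) =
        u.baseBasis i
      rw [Module.Basis.constr_basis, map_add, map_sum]
      simp only [map_smul, u.vertical, smul_zero, Finset.sum_const_zero, add_zero,
        AdaptedFrame.baseBasis_apply] }

theorem ofCoord_apply (u : p.AdaptedFrame e) (ξ : Matrix (Fin k) (Fin n) ℝ) (i : Fin n) :
    (ofCoord u ξ).toLin (p.tangentMapAt e (u.basis (Sum.inl i))) =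
      u.basis (Sum.inl i) + ∑ A, ξ A i • u.basis (Sum.inr A) := by
  rw [← AdaptedFrame.baseBasis_apply]
  exact Module.Basis.constr_basis u.baseBasis ℝ _ i

/-- The coordinates `ξ^A_i` of a jet `τ` with respect to an adapted frame, defined by
`τ(π_* e_i) = e_i + ξ^A_i e_A`. For the coordinate frame of an adapted chart these are the
standard jet coordinates `y^A_i`. -/
def matrixCoord (u : p.AdaptedFrame e) : p.Jet e ≃ Matrix (Fin k) (Fin n) ℝ where
  toFun τ := Matrix.of fun A i =>
    u.basis.repr (τ.toLin (p.tangentMapAt e (u.basis (Sum.inl i)))) (Sum.inr A)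
  invFun ξ := ofCoord u ξ
  left_inv τ := by
    refine Jet.ext (ContinuousLinearMap.coe_injective (u.baseBasis.ext fun i => ?_))
    change (ofCoord u _).toLin (u.baseBasis i) = τ.toLin (u.baseBasis i)
    rw [AdaptedFrame.baseBasis_apply, ofCoord_apply]
    conv_rhs => rw [← u.basis.sum_repr (τ.toLin _), Fintype.sum_sum_type]
    simp only [← AdaptedFrame.baseBasis_repr, tangentMapAt_apply, Matrix.of_apply]
    congr 1
    simp only [← AdaptedFrame.baseBasis_apply, Module.Basis.repr_self]
    simp [Finsupp.single_apply, -AdaptedFrame.baseBasis_apply]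
  right_inv ξ := by
    ext A i
    change u.basis.repr ((ofCoord u ξ).toLin (p.tangentMapAt e (u.basis (Sum.inl i)))) (Sum.inr A) =
      ξ A i
    rw [ofCoord_apply]
    simp [Finsupp.single_apply]

theorem apply_eq (u : p.AdaptedFrame e) (τ : p.Jet e) (i : Fin n) :
    τ.toLin (p.tangentMapAt e (u.basis (Sum.inl i))) =
      u.basis (Sum.inl i) + ∑ A, matrixCoord u τ A i • u.basis (Sum.inr A) := by
  conv_lhs => rw [← (matrixCoord u).symm_apply_apply τ]
  exact ofCoord_apply u _ i

theorem matrixCoord_act (u : p.AdaptedFrame e) (g : GV n k) (τ : p.Jet e) :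
    matrixCoord u τ = g.C * g.A⁻¹ + g.B * matrixCoord (u.act g) τ * g.A⁻¹ := by
  have key : matrixCoord u τ * g.A = g.C + g.B * matrixCoord (u.act g) τ := by
    ext B j
    have h := apply_eq (u.act g) τ j
    have h2 := congrArg (fun v => u.basis.repr v (Sum.inr B)) h
    simp only [AdaptedFrame.act_basis_inl, AdaptedFrame.act_basis_inr, map_add, map_sum, map_smul,
      u.vertical, apply_eq] at h2
    simp only [Matrix.mul_apply, Matrix.add_apply]
    simpa [Finsupp.single_apply, Finset.sum_apply, mul_comm] using h2
  rw [← Matrix.add_mul, ← key, Matrix.mul_nonsing_inv_cancel_right _ _ g.isUnit_det_A]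

/-- The affine structure of the fibres of `J¹π → E`. -/
instance : AddTorsor (p.JetDirection e) (p.Jet e) where
  vadd σ τ := ⟨σ.1 + τ.toLin, fun w => by
    change p.tangentMapAt e (σ.1 w + τ.toLin w) = w
    rw [map_add, σ.2 w, τ.tangentMapAt_apply, zero_add]⟩
  zero_vadd τ := Jet.ext (zero_add _)
  add_vadd σ σ' τ := Jet.ext (add_assoc _ _ _)
  vsub τ τ' := ⟨τ.toLin - τ'.toLin, fun w => by
    change p.tangentMapAt e (τ.toLin w - τ'.toLin w) = 0
    rw [map_sub, τ.tangentMapAt_apply, τ'.tangentMapAt_apply, sub_self]⟩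
  nonempty := ⟨ofCoord (Classical.arbitrary (p.AdaptedFrame e)) 0⟩
  vsub_vadd' τ τ' := Jet.ext (sub_add_cancel _ _)
  vadd_vsub' σ τ := Subtype.ext (add_sub_cancel_right _ _)

end Jet

/-! ### Topology and smooth structure of the bundles over `E` -/

variable [IsManifold (𝓡 (n + k)) ∞ E]

namespace LocalAdaptedFrame

variable {p} (s s' : p.LocalAdaptedFrame)

open Classical in
/-- The value at `e` of a local section of the adapted frame bundle (and an arbitrary adapted
frame if `e` is not in the domain). -/
def frameAt (e : E) : p.AdaptedFrame e :=
  if he : e ∈ s.domain then ⟨s.isLocalFrameOn.toBasisAt he, fun A => by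
    rw [IsLocalFrameOn.toBasisAt_coe]; exact s.vertical e he A⟩
  else Classical.arbitrary _

theorem frameAt_basis {e : E} (he : e ∈ s.domain) (α : Fin n ⊕ Fin k) :
    (s.frameAt e).basis α = s.vec α e := by
  rw [frameAt, dif_pos he]
  exact s.isLocalFrameOn.toBasisAt_coe he α

/-- The transition function between two local sections of the adapted frame bundle. -/
def transition (e : E) : GV n k := Classical.choose ((s.frameAt e).exists_act_eq (s'.frameAt e))

theorem act_transition (e : E) : (s.frameAt e).act (s.transition s' e) = s'.frameAt e :=
  (Classical.choose_spec ((s.frameAt e).exists_act_eq (s'.frameAt e))).symm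

theorem continuousOn_transition :
    ContinuousOn (fun e => (s.transition s' e).1.1) (s.domain ∩ s'.domain) := by
  intro e₀ he₀
  let t := trivializationAt (EuclideanSpace ℝ (Fin (n + k)))
    (TangentSpace (𝓡 (n + k)) : E → Type _) e₀
  have inst : MemTrivializationAtlas t := inferInstance
  let b : Module.Basis (Fin (n + k)) ℝ (EuclideanSpace ℝ (Fin (n + k))) :=
    (EuclideanSpace.basisFun (Fin (n + k)) ℝ).toBasis
  let b' : Module.Basis (Fin n ⊕ Fin k) ℝ (EuclideanSpace ℝ (Fin (n + k))) :=
    b.reindex finSumFinEquiv.symm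
  have ht : e₀ ∈ t.baseSet := FiberBundle.mem_baseSet_trivializationAt (EuclideanSpace ℝ (Fin (n + k)))
    (TangentSpace (𝓡 (n + k)) : E → Type _) e₀
  let mat (r : p.LocalAdaptedFrame) (e : E) : Matrix (Fin n ⊕ Fin k) (Fin n ⊕ Fin k) ℝ :=
    Matrix.of fun α β => b'.repr (t ⟨e, r.vec β e⟩).2 α
  have hcont : ∀ (r : p.LocalAdaptedFrame), e₀ ∈ r.domain → ContinuousAt (mat r) e₀ := by
    intro r hr
    refine continuousAt_pi.2 fun α => continuousAt_pi.2 fun β => ?_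
    have h1 : ContinuousAt (fun e => (⟨e, r.vec β e⟩ : TangentBundle (𝓡 (n + k)) E)) e₀ :=
      ((r.isLocalFrameOn.contMDiffOn β).continuousOn).continuousAt (r.isOpen_domain.mem_nhds hr)
    have h2 : ContinuousAt (fun e => (t ⟨e, r.vec β e⟩).2) e₀ :=
      continuous_snd.continuousAt.comp
        (ContinuousAt.comp (g := t) (t.continuousAt (t.mem_source.2 ht)) h1)
    exact (LinearMap.continuous_of_finiteDimensional (b'.coord α)).continuousAt.comp h2
  have hmul : ∀ e ∈ t.baseSet, e ∈ s.domain → e ∈ s'.domain →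
      mat s' e = mat s e * (s.transition s' e).1.1 := by
    intro e he hs hs'
    ext α β
    have h := congrArg (fun u : p.AdaptedFrame e => u.basis β) (s.act_transition s' e)
    simp only [AdaptedFrame.act_basis, frameAt_basis _ hs, frameAt_basis _ hs'] at h
    have h2 := congrArg (fun v => b'.repr (t.continuousLinearEquivAt ℝ e he v) α) h
    simp only [map_sum, map_smul, Finsupp.coe_finsetSum, Finset.sum_apply, Finsupp.smul_apply,
      smul_eq_mul] at h2
    rw [Matrix.mul_apply]
    refine h2.symm.trans (Finset.sum_congr rfl fun γ _ => mul_comm _ _)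
  have hdet : ∀ e ∈ t.baseSet, e ∈ s.domain → IsUnit (mat s e).det := by
    intro e he hs
    let c := (s.isLocalFrameOn.toBasisAt hs).map (t.continuousLinearEquivAt ℝ e he).toLinearEquiv
    have hc : mat s e = b'.toMatrix c := by
      ext α β
      change _ = b'.repr (t.continuousLinearEquivAt ℝ e he (s.isLocalFrameOn.toBasisAt hs β)) α
      rw [IsLocalFrameOn.toBasisAt_coe]
      rfl
    rw [hc]
    have := b'.invertibleToMatrix c
    exact (Matrix.isUnit_iff_isUnit_det _).1 (isUnit_of_invertible _)
  have hev : ∀ᶠ e in nhds e₀, (mat s e)⁻¹ * mat s' e = (s.transition s' e).1.1 := by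
    filter_upwards [t.open_baseSet.mem_nhds ht, s.isOpen_domain.mem_nhds he₀.1,
      s'.isOpen_domain.mem_nhds he₀.2] with e h1 h2 h3
    rw [hmul e h1 h2 h3, Matrix.nonsing_inv_mul_cancel_left _ _ (hdet e h1 h2)]
  refine (ContinuousAt.congr ?_ hev).continuousWithinAt
  have hmat : ContinuousAt (fun e => ((mat s e).det)⁻¹ • (mat s e).adjugate * mat s' e) e₀ := by
    have h1 := hcont s he₀.1
    have h2 := hcont s' he₀.2
    have h3 : ContinuousAt (fun e => (mat s e).det) e₀ :=
      (continuous_id.matrix_det).continuousAt.comp h1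
    have h4 : ContinuousAt (fun e => (mat s e).adjugate) e₀ :=
      (continuous_id.matrix_adjugate).continuousAt.comp h1
    have h5 := (h3.inv₀ (hdet e₀ ht he₀.1).ne_zero).smul h4
    have h6 : Continuous (fun q : Matrix (Fin n ⊕ Fin k) (Fin n ⊕ Fin k) ℝ ×
        Matrix (Fin n ⊕ Fin k) (Fin n ⊕ Fin k) ℝ => q.1 * q.2) :=
      continuous_fst.matrix_mul continuous_snd
    exact (h6.tendsto _).comp (h5.tendsto.prodMk_nhds h2.tendsto)
  simpa only [Matrix.inv_def, Ring.inverse_eq_inv'] using hmat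

end LocalAdaptedFrame

/-- Given identifications `c u` of `A e` with `ℝ^{kn}`, one for each adapted frame `u` at `e`,
a local section `s` of the adapted frame bundle over `U` yields the bijection
`A|_U ≃ U × ℝ^{kn}`, `a ↦ (e, c (s e) a)`. -/
def pretrivialization {A : E → Type*}
    (c : ∀ {e : E}, p.AdaptedFrame e → A e ≃ Matrix (Fin k) (Fin n) ℝ)
    (s : p.LocalAdaptedFrame) :
    Pretrivialization (Fin k → Fin n → ℝ) (π (Fin k → Fin n → ℝ) A) where
  toFun a := (a.1, Matrix.of.symm (c (s.frameAt a.1) a.2))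
  invFun q := ⟨q.1, (c (s.frameAt q.1)).symm (Matrix.of q.2)⟩
  source := TotalSpace.proj ⁻¹' s.domain
  target := s.domain ×ˢ Set.univ
  map_source' a ha := ⟨ha, trivial⟩
  map_target' q hq := hq.1
  left_inv' a _ := by simp
  right_inv' q _ := by simp
  open_target := s.isOpen_domain.prod isOpen_univ
  baseSet := s.domain
  open_baseSet := s.isOpen_domain
  source_eq := rfl
  target_eq := rfl
  proj_toFun _ _ := rfl

/-- The fibre bundle with fibres `A e` and typical fibre `ℝ^{kn}` whose topology is determined
by the local trivializations attached to a family of local sections of the adapted frame bundle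
covering `E`. -/
def prebundle {A : E → Type*} [∀ e, TopologicalSpace (A e)]
    (c : ∀ {e : E}, p.AdaptedFrame e → A e ≃ Matrix (Fin k) (Fin n) ℝ)
    (hc : ∀ {e : E} (u : p.AdaptedFrame e) (g : GV n k) (a : A e),
      c u a = g.C * g.A⁻¹ + g.B * c (u.act g) a * g.A⁻¹)
    {ι : Type*} (fr : ι → p.LocalAdaptedFrame) (ix : E → ι)
    (hix : ∀ e, e ∈ (fr (ix e)).domain)
    (hind : ∀ e, Topology.IsInducing fun a : A e => Matrix.of.symm (c ((fr (ix e)).frameAt e) a)) :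
    FiberPrebundle (Fin k → Fin n → ℝ) A where
  pretrivializationAtlas := Set.range fun i => p.pretrivialization c (fr i)
  pretrivializationAt e := p.pretrivialization c (fr (ix e))
  mem_base_pretrivializationAt := hix
  pretrivialization_mem_atlas e := ⟨ix e, rfl⟩
  continuous_trivChange := by
    rintro _ ⟨i, rfl⟩ _ ⟨j, rfl⟩
    have hdom : ∀ q ∈ (p.pretrivialization c (fr j)).target ∩
        (p.pretrivialization c (fr j)).toPartialEquiv.symm ⁻¹'
          (p.pretrivialization c (fr i)).source, q.1 ∈ (fr i).domain ∩ (fr j).domain :=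
      fun q hq => ⟨hq.2, hq.1.1⟩
    have hT : ContinuousOn (fun q : E × (Fin k → Fin n → ℝ) =>
        ((fr i).transition (fr j) q.1).1.1) ((p.pretrivialization c (fr j)).target ∩
        (p.pretrivialization c (fr j)).toPartialEquiv.symm ⁻¹'
          (p.pretrivialization c (fr i)).source) :=
      ((fr i).continuousOn_transition (fr j)).comp continuous_fst.continuousOn hdom
    have h11 : Continuous fun m : Matrix (Fin n ⊕ Fin k) (Fin n ⊕ Fin k) ℝ => m.toBlocks₁₁ :=
      continuous_id.matrix_submatrix Sum.inl Sum.inl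
    have h21 : Continuous fun m : Matrix (Fin n ⊕ Fin k) (Fin n ⊕ Fin k) ℝ => m.toBlocks₂₁ :=
      continuous_id.matrix_submatrix Sum.inr Sum.inl
    have h22 : Continuous fun m : Matrix (Fin n ⊕ Fin k) (Fin n ⊕ Fin k) ℝ => m.toBlocks₂₂ :=
      continuous_id.matrix_submatrix Sum.inr Sum.inr
    have hA := h11.comp_continuousOn hT
    have hC := h21.comp_continuousOn hT
    have hB := h22.comp_continuousOn hT
    have hAi : ContinuousOn (fun q : E × (Fin k → Fin n → ℝ) =>
        (((fr i).transition (fr j) q.1).A)⁻¹) ((p.pretrivialization c (fr j)).target ∩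
        (p.pretrivialization c (fr j)).toPartialEquiv.symm ⁻¹'
          (p.pretrivialization c (fr i)).source) := by
      simp only [Matrix.inv_def, Ring.inverse_eq_inv']
      refine ContinuousOn.smul (ContinuousOn.inv₀
        (continuous_id.matrix_det.comp_continuousOn hA) ?_)
        (continuous_id.matrix_adjugate.comp_continuousOn hA)
      exact fun q _ => (GV.isUnit_det_A _).ne_zero
    have hmul1 : Continuous (fun q : Matrix (Fin k) (Fin n) ℝ × Matrix (Fin n) (Fin n) ℝ =>
      q.1 * q.2) := continuous_fst.matrix_mul continuous_snd
    have hmul2 : Continuous (fun q : Matrix (Fin k) (Fin k) ℝ × Matrix (Fin k) (Fin n) ℝ =>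
      q.1 * q.2) := continuous_fst.matrix_mul continuous_snd
    have hS : ContinuousOn (fun q : E × (Fin k → Fin n → ℝ) => Matrix.of q.2)
        ((p.pretrivialization c (fr j)).target ∩
        (p.pretrivialization c (fr j)).toPartialEquiv.symm ⁻¹'
          (p.pretrivialization c (fr i)).source) := continuous_snd.continuousOn
    refine (continuous_fst.continuousOn.prodMk
      ((hmul1.comp_continuousOn (hC.prodMk hAi)).add (hmul1.comp_continuousOn
        ((hmul2.comp_continuousOn (hB.prodMk hS)).prodMk hAi)))).congr ?_
    intro q hq
    refine Prod.ext rfl ?_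
    change Matrix.of.symm (c ((fr i).frameAt q.1)
      ((c ((fr j).frameAt q.1)).symm (Matrix.of q.2))) = _
    rw [hc _ ((fr i).transition (fr j) q.1), (fr i).act_transition (fr j), Equiv.apply_symm_apply]
    rfl
  totalSpaceMk_isInducing e := by
    exact (isInducing_prodMkRight (Y := Fin k → Fin n → ℝ) e).comp (hind e)

/-- A choice of an adapted chart around each point. -/
def adaptedChartAt (e : E) : p.AdaptedChart := Classical.choose (p.exists_adaptedChart e)

theorem mem_adaptedChartAt_source (e : E) : e ∈ (p.adaptedChartAt e).total.source :=
  Classical.choose_spec (p.exists_adaptedChart e)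

/-! The associated bundle `L_π E ×_{G_V} (G_V / H)`: its local trivializations are
`[s(e), ξ] ↦ (e, ξ)`, for all smooth local sections `s` of `L_π E`. -/

instance (e : E) : TopologicalSpace (p.AssociatedHomogeneous e) :=
  TopologicalSpace.induced
    (fun a => Matrix.of.symm (Associated.matrixCoord ((p.adaptedChartAt e).frame.frameAt e) a))
    inferInstance

/-- The local trivializations of the associated bundle `L_π E ×_{G_V} (G_V / H)`. -/
def associatedPrebundle : FiberPrebundle (Fin k → Fin n → ℝ) p.AssociatedHomogeneous :=
  p.prebundle (fun u => Associated.matrixCoord u) (fun u g a => Associated.matrixCoord_act u g a)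
    id (fun e => (p.adaptedChartAt e).frame) p.mem_adaptedChartAt_source
    (fun _ => Topology.IsInducing.induced _)

instance : TopologicalSpace (TotalSpace (Fin k → Fin n → ℝ) p.AssociatedHomogeneous) :=
  p.associatedPrebundle.totalSpaceTopology

instance : FiberBundle (Fin k → Fin n → ℝ) p.AssociatedHomogeneous :=
  p.associatedPrebundle.toFiberBundle

/-! The jet bundle `J¹π`: its local trivializations are the standard jet coordinates `y^A_i`
of adapted charts. -/

instance (e : E) : TopologicalSpace (p.Jet e) :=
  TopologicalSpace.induced
    (fun τ => Matrix.of.symm (Jet.matrixCoord ((p.adaptedChartAt e).frame.frameAt e) τ))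
    inferInstance

/-- The local trivializations of `J¹π → E`. -/
def jetPrebundle : FiberPrebundle (Fin k → Fin n → ℝ) p.Jet :=
  p.prebundle (fun u => Jet.matrixCoord u) (fun u g a => Jet.matrixCoord_act u g a)
    (fun c : p.AdaptedChart => c.frame) p.adaptedChartAt p.mem_adaptedChartAt_source
    (fun _ => Topology.IsInducing.induced _)

instance : TopologicalSpace (TotalSpace (Fin k → Fin n → ℝ) p.Jet) :=
  p.jetPrebundle.totalSpaceTopology

instance : FiberBundle (Fin k → Fin n → ℝ) p.Jet :=
  p.jetPrebundle.toFiberBundle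

end SmoothFiberBundle

end Bundles

/-! ### Smooth affine bundles -/

/-- A fibre bundle `A → B` with typical fibre a vector space `W`, whose fibres `A b` are affine
spaces modelled on vector spaces `V b`, is a smooth affine bundle if its total space is a smooth
manifold and if around every point of `B` there is a smooth local trivialization which restricts
to an affine isomorphism `A b ≃ W` on each fibre. -/
structure IsSmoothAffineBundle (m : ℕ) {B : Type*} [TopologicalSpace B]
    [ChartedSpace (EuclideanSpace ℝ (Fin m)) B]
    (W : Type*) [NormedAddCommGroup W] [NormedSpace ℝ W] (V A : B → Type*)
    [∀ b, AddCommGroup (V b)] [∀ b, Module ℝ (V b)] [∀ b, AddTorsor (V b) (A b)]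
    [TopologicalSpace (TotalSpace W A)] [∀ b, TopologicalSpace (A b)] [FiberBundle W A] :
    Prop where
  isManifold : IsManifold ((𝓡 m).prod 𝓘(ℝ, W)) ∞ (TotalSpace W A)
  exists_trivialization (b : B) : ∃ t : Bundle.Trivialization W (π W A), b ∈ t.baseSet ∧
    ContMDiffOn ((𝓡 m).prod 𝓘(ℝ, W)) ((𝓡 m).prod 𝓘(ℝ, W)) ∞ t t.source ∧
    ContMDiffOn ((𝓡 m).prod 𝓘(ℝ, W)) ((𝓡 m).prod 𝓘(ℝ, W)) ∞
      t.toOpenPartialHomeomorph.symm t.target ∧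
    ∀ b' ∈ t.baseSet, ∃ α : A b' ≃ᵃ[ℝ] W, ∀ a : A b', t ⟨b', a⟩ = (b', α a)

/-- An isomorphism of smooth affine bundles over the identity of `B`: a family of affine
isomorphisms of the fibres such that the induced bijection of the total spaces is a
diffeomorphism. -/
structure SmoothAffineBundleEquiv (m : ℕ) {B : Type*} [TopologicalSpace B]
    [ChartedSpace (EuclideanSpace ℝ (Fin m)) B]
    (W : Type*) [NormedAddCommGroup W] [NormedSpace ℝ W] (V A V' A' : B → Type*)
    [∀ b, AddCommGroup (V b)] [∀ b, Module ℝ (V b)] [∀ b, AddTorsor (V b) (A b)]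
    [TopologicalSpace (TotalSpace W A)] [∀ b, TopologicalSpace (A b)] [FiberBundle W A]
    [∀ b, AddCommGroup (V' b)] [∀ b, Module ℝ (V' b)] [∀ b, AddTorsor (V' b) (A' b)]
    [TopologicalSpace (TotalSpace W A')] [∀ b, TopologicalSpace (A' b)] [FiberBundle W A'] where
  /-- The affine isomorphism of the fibres over `b`. -/
  fiberEquiv (b : B) : A b ≃ᵃ[ℝ] A' b
  contMDiff_toFun : ContMDiff ((𝓡 m).prod 𝓘(ℝ, W)) ((𝓡 m).prod 𝓘(ℝ, W)) ∞
    (fun a : TotalSpace W A => (⟨a.1, fiberEquiv a.1 a.2⟩ : TotalSpace W A'))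
  contMDiff_invFun : ContMDiff ((𝓡 m).prod 𝓘(ℝ, W)) ((𝓡 m).prod 𝓘(ℝ, W)) ∞
    (fun a : TotalSpace W A' => (⟨a.1, (fiberEquiv a.1).symm a.2⟩ : TotalSpace W A))

end

/-! An adapted frame `u = (e_i, e_A)` at `e` turns both fibres into `ℝ^{kn}`: the class `[u, ξ]` has
coordinate `ξ`, and a jet `τ` has the coordinate `ξ` determined by `τ(π_* e_i) = e_i + ξ^A_i e_A`.
The whole theorem rests on one coincidence: when `u` is replaced by `u · g`, with `g = [A 0; C B]`,
both coordinates obey the same affine law `ξ = C A⁻¹ + B ξ' A⁻¹`, where `ξ'` is the coordinate with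
respect to `u · g` (`Associated.matrixCoord_act` and `Jet.matrixCoord_act`). Hence "same coordinate"
is a relation between classes and jets that does not depend on the frame. It is bijective and affine
because both coordinates are, and by construction it sends `[u, ξ]` to the required jet
(`matrixCoord_jetEquiv`).

Smoothness is a property of the transition functions. If `s` and `s'` are smooth local adapted
frames with `s' = s · g`, then `g` is the product of an inverse matrix of smooth functions with a
matrix of smooth functions, so it is smooth by Cramer's rule (`contMDiffAt_transition_apply`).
Therefore the affine law depends smoothly on `(e, ξ')` (`contMDiffAt_coordChange`). This makes the
total space a manifold and each frame trivialization a diffeomorphism onto its target.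

Since only the transformation law matters, this part is carried out once, for any family of fibres
`A e` with coordinates `c u` obeying the law, and is then applied to both bundles. A fibrewise map
that preserves the coordinates is the identity in matching trivializations, hence smooth
(`contMDiff_of_coord_eq`); this applies to the isomorphism and to its inverse. -/

noncomputable section

/-! ### Smoothness of determinants and inverse matrices. -/

section MatrixSmoothness

variable {EM HM X m : Type*} [NormedAddCommGroup EM] [NormedSpace ℝ EM] [TopologicalSpace HM]
  {I : ModelWithCorners ℝ EM HM} [TopologicalSpace X] [ChartedSpace HM X] [Fintype m]
  [DecidableEq m] {f : X → Matrix m m ℝ} {x : X}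

theorem contMDiffAt_matrix_det (hf : ∀ i j, ContMDiffAt I 𝓘(ℝ) ∞ (fun y => f y i j) x) :
    ContMDiffAt I 𝓘(ℝ) ∞ (fun y => (f y).det) x := by
  simp only [Matrix.det_apply']
  exact ContMDiffAt.sum fun σ _ => contMDiffAt_const.mul
    (contMDiffAt_finsetProd fun i _ => hf (σ i) i)

/-- Cramer's rule: the inverse is `det⁻¹` times the adjugate, and each entry of the adjugate is the
determinant of the matrix with one row replaced by a constant basis vector. Working entry by entry
avoids choosing a norm on matrices. -/
theorem contMDiffAt_matrix_inv_apply (hf : ∀ i j, ContMDiffAt I 𝓘(ℝ) ∞ (fun y => f y i j) x)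
    (hx : IsUnit (f x).det) (i j : m) :
    ContMDiffAt I 𝓘(ℝ) ∞ (fun y => (f y)⁻¹ i j) x := by
  simp only [Matrix.inv_def, Ring.inverse_eq_inv', Matrix.smul_apply, smul_eq_mul,
    Matrix.adjugate_apply]
  refine ((contMDiffAt_matrix_det hf).inv₀ hx.ne_zero).mul (contMDiffAt_matrix_det fun a b => ?_)
  simp only [Matrix.updateRow_apply]
  split_ifs
  · exact contMDiffAt_const
  · exact hf a b

end MatrixSmoothness

/-! ### Smooth transition functions make the total space a manifold. -/

section Manifold

variable {EB HB B W : Type*} [NormedAddCommGroup EB] [NormedSpace ℝ EB] [TopologicalSpace HB]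
  {IB : ModelWithCorners ℝ EB HB} [TopologicalSpace B] [ChartedSpace HB B]
  [NormedAddCommGroup W] [NormedSpace ℝ W] {A : B → Type*}
  [TopologicalSpace (TotalSpace W A)] [∀ b, TopologicalSpace (A b)] [FiberBundle W A]

variable (IB W B) in
/-- The pregroupoid of smooth maps between open subsets of `B × W`. -/
def contMDiffProdPregroupoid : Pregroupoid (B × W) where
  property f s := ContMDiffOn (IB.prod 𝓘(ℝ, W)) (IB.prod 𝓘(ℝ, W)) ∞ f s
  comp hf hg _ _ _ := hg.comp' hf
  id_mem := contMDiffOn_id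
  locality _ h := fun x hx => by
    obtain ⟨v, hv, hxv, hf⟩ := h x hx
    exact (contMDiffWithinAt_inter (hv.mem_nhds hxv)).1 (hf x ⟨hx, hxv⟩)
  congr _ h hf := hf.congr h

/-- The total space of a fibre bundle whose trivialization atlas has smooth transition
functions is a smooth manifold. -/
theorem FiberBundle.isManifold_totalSpace [IsManifold IB ∞ B]
    (h : ∀ t ∈ trivializationAtlas W A, ∀ t' ∈ trivializationAtlas W A,
      ContMDiffOn (IB.prod 𝓘(ℝ, W)) (IB.prod 𝓘(ℝ, W)) ∞
        (t.toOpenPartialHomeomorph.symm.trans t'.toOpenPartialHomeomorph)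
        (t.toOpenPartialHomeomorph.symm.trans t'.toOpenPartialHomeomorph).source) :
    IsManifold (IB.prod 𝓘(ℝ, W)) ∞ (TotalSpace W A) := by
  have hG : HasGroupoid (TotalSpace W A) (contMDiffProdPregroupoid B W IB).groupoid := by
    refine hasGroupoid_of_pregroupoid _ ?_
    rintro _ _ ⟨t, ht, rfl⟩ ⟨t', ht', rfl⟩
    exact h t ht t' ht'
  -- The charts of the total space are trivializations followed by charts of `B × W`. Their changes
  -- are smooth once every transition map between trivializations is a local structomorphism of `B ×
  -- W`, that is, smooth together with its inverse; this is what membership in the groupoid of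
  -- `contMDiffProdPregroupoid` means.
  refine { StructureGroupoid.HasGroupoid.comp
    (contMDiffProdPregroupoid B W IB).groupoid ?_ with }
  intro e he
  rw [isLocalStructomorphOn_contDiffGroupoid_iff]
  exact he

end Manifold

/-! ### Affine coordinates on the fibres and the fibrewise isomorphism. -/

namespace SmoothFiberBundle

variable {n k : ℕ} {M E F : Type*}
  [TopologicalSpace M] [ChartedSpace (EuclideanSpace ℝ (Fin n)) M]
  [TopologicalSpace E] [ChartedSpace (EuclideanSpace ℝ (Fin (n + k))) E]
  [TopologicalSpace F] [ChartedSpace (EuclideanSpace ℝ (Fin k)) F]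
  {p : SmoothFiberBundle n k M E F}
  [IsManifold (𝓡 n) ∞ M] [IsManifold (𝓡 k) ∞ F] {e : E}

/-- The coordinate `ξ` of the classes `[u, ξ]`, as an affine isomorphism. -/
def Associated.affineCoord (u : p.AdaptedFrame e) :
    p.AssociatedHomogeneous e ≃ᵃ[ℝ] (Fin k → Fin n → ℝ) where
  toEquiv := (Associated.matrixCoord u).trans Matrix.of.symm
  -- The linear part is built as the inverse of `v ↦ [u, v]`, because the frame independence of the
  -- vector space structure is available for `mk u`.
  linear := LinearEquiv.symm
    { toFun := fun v => Associated.mk u (Matrix.of v)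
      map_add' := fun v w => Associated.mk_add u (Matrix.of v) (Matrix.of w)
      map_smul' := fun r v => Associated.mk_smul u r (Matrix.of v)
      invFun := fun v => Matrix.of.symm (Associated.coord u v)
      left_inv := fun v => Associated.coord_mk u (Matrix.of v)
      right_inv := fun v => Associated.mk_coord u v }
  map_vadd' a v := by
    obtain ⟨x, rfl⟩ := (Associated.mk_bijective u).2 a
    obtain ⟨w, rfl⟩ := (Associated.mk_bijective u).2 v
    rw [← Associated.mk_vadd]
    change HomogeneousSpace.coord n k (Associated.coord u (Associated.mk u (w +ᵥ x))) =
      Associated.coord u (Associated.mk u w) +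
        HomogeneousSpace.coord n k (Associated.coord u (Associated.mk u x))
    rw [Associated.coord_mk, Associated.coord_mk, Associated.coord_mk,
      HomogeneousSpace.coord_vadd]

/-- The coordinates `ξ^A_i` of jets with respect to an adapted frame, as an affine map. -/
def Jet.affineMapCoord (u : p.AdaptedFrame e) : p.Jet e →ᵃ[ℝ] (Fin k → Fin n → ℝ) where
  toFun τ := Matrix.of.symm (Jet.matrixCoord u τ)
  linear :=
    { toFun := fun σ A i =>
        u.basis.repr (σ.1 (p.tangentMapAt e (u.basis (Sum.inl i)))) (Sum.inr A)
      map_add' := fun σ σ' => by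
        ext A i
        exact congrArg (fun w => w (Sum.inr A)) (map_add u.basis.repr _ _)
      map_smul' := fun r σ => by
        ext A i
        exact congrArg (fun w => w (Sum.inr A)) (map_smul u.basis.repr r _) }
  map_vadd' τ σ := by
    ext A i
    exact congrArg (fun w => w (Sum.inr A)) (map_add u.basis.repr _ _)

/-- The coordinates `ξ^A_i` of jets with respect to an adapted frame, as an affine isomorphism. -/
def Jet.affineCoord (u : p.AdaptedFrame e) : p.Jet e ≃ᵃ[ℝ] (Fin k → Fin n → ℝ) :=
  -- Bijectivity comes from `Jet.matrixCoord`, whose inverse builds a jet from prescribed values on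
  -- the basis `π_* e_i`.
  AffineEquiv.ofBijective (φ := Jet.affineMapCoord u)
    ((Jet.matrixCoord u).trans Matrix.of.symm).bijective

variable (p) in
/-- The affine isomorphism `[u, ξ] ↦ (π_* e_i ↦ e_i + ξ^A_i e_A)`. -/
def jetEquiv (e : E) : p.AssociatedHomogeneous e ≃ᵃ[ℝ] p.Jet e :=
  (Associated.affineCoord (Classical.arbitrary (p.AdaptedFrame e))).trans
    (Jet.affineCoord (Classical.arbitrary (p.AdaptedFrame e))).symm

/-- Independence of the frame chosen in `jetEquiv`. In that frame the two coordinates agree by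
construction; passing to `u` changes both by the same law, so they still agree. -/
theorem matrixCoord_jetEquiv (u : p.AdaptedFrame e) (a : p.AssociatedHomogeneous e) :
    Jet.matrixCoord u (p.jetEquiv e a) = Associated.matrixCoord u a := by
  have h0 : Jet.matrixCoord (Classical.arbitrary (p.AdaptedFrame e)) (p.jetEquiv e a) =
      Associated.matrixCoord (Classical.arbitrary (p.AdaptedFrame e)) a :=
    (Jet.affineCoord (Classical.arbitrary (p.AdaptedFrame e))).apply_symm_apply _
  obtain ⟨g, hg⟩ := u.exists_act_eq (Classical.arbitrary (p.AdaptedFrame e))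
  rw [Jet.matrixCoord_act u g, Associated.matrixCoord_act u g, ← hg, h0]

variable [IsManifold (𝓡 (n + k)) ∞ E]

/-! ### Smooth change of local adapted frames. -/

namespace LocalAdaptedFrame

variable (s s' : p.LocalAdaptedFrame)

/-- Near `e₀`, write the vectors of each frame as columns of a matrix by means of a trivialization
of `TE`. The columns are smooth, and `s' = s · g` becomes a matrix identity that can be solved for
`g`. -/
theorem contMDiffAt_transition_apply {e₀ : E} (hs : e₀ ∈ s.domain) (hs' : e₀ ∈ s'.domain)
    (α β : Fin n ⊕ Fin k) :
    ContMDiffAt (𝓡 (n + k)) 𝓘(ℝ) ∞ (fun e => (s.transition s' e).1.1 α β) e₀ := by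
  let t := trivializationAt (EuclideanSpace ℝ (Fin (n + k)))
    (TangentSpace (𝓡 (n + k)) : E → Type _) e₀
  have inst : MemTrivializationAtlas t := inferInstance
  let b : Module.Basis (Fin n ⊕ Fin k) ℝ (EuclideanSpace ℝ (Fin (n + k))) :=
    (EuclideanSpace.basisFun (Fin (n + k)) ℝ).toBasis.reindex finSumFinEquiv.symm
  have ht : e₀ ∈ t.baseSet :=
    FiberBundle.mem_baseSet_trivializationAt (EuclideanSpace ℝ (Fin (n + k)))
      (TangentSpace (𝓡 (n + k)) : E → Type _) e₀
  let mat (r : p.LocalAdaptedFrame) (e : E) : Matrix (Fin n ⊕ Fin k) (Fin n ⊕ Fin k) ℝ :=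
    Matrix.of fun α β => b.repr (t ⟨e, r.vec β e⟩).2 α
  have hsmooth : ∀ r : p.LocalAdaptedFrame, e₀ ∈ r.domain → ∀ α β,
      ContMDiffAt (𝓡 (n + k)) 𝓘(ℝ) ∞ (fun e => mat r e α β) e₀ := by
    intro r hr α β
    -- Smoothness of a vector field at `e₀` is by definition tested in the preferred trivialization
    -- at `e₀`, which is why `t` is that one.
    have h1 := (contMDiffAt_totalSpace.1
      (r.isLocalFrameOn.contMDiffAt r.isOpen_domain hr β)).2
    exact (LinearMap.toContinuousLinearMap (b.coord α)).contMDiff.contMDiffAt.comp e₀ h1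
  have hmul : ∀ e ∈ t.baseSet, e ∈ s.domain → e ∈ s'.domain →
      mat s' e = mat s e * (s.transition s' e).1.1 := by
    intro e he hs hs'
    ext α β
    have h := congrArg (fun u : p.AdaptedFrame e => u.basis β) (s.act_transition s' e)
    simp only [AdaptedFrame.act_basis, frameAt_basis _ hs, frameAt_basis _ hs'] at h
    have h2 := congrArg (fun v => b.repr (t.continuousLinearEquivAt ℝ e he v) α) h
    simp only [map_sum, map_smul, Finsupp.coe_finsetSum, Finset.sum_apply, Finsupp.smul_apply,
      smul_eq_mul] at h2
    rw [Matrix.mul_apply]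
    exact h2.symm.trans (Finset.sum_congr rfl fun γ _ => mul_comm _ _)
  -- `mat s e` is the change of basis matrix from the fixed basis `b` to the image of the frame
  -- under `t`, hence invertible.
  have hdet : ∀ e ∈ t.baseSet, e ∈ s.domain → IsUnit (mat s e).det := by
    intro e he hs
    let c := (s.isLocalFrameOn.toBasisAt hs).map (t.continuousLinearEquivAt ℝ e he).toLinearEquiv
    have hc : mat s e = b.toMatrix c := by
      ext α β
      change _ = b.repr (t.continuousLinearEquivAt ℝ e he (s.isLocalFrameOn.toBasisAt hs β)) α
      rw [IsLocalFrameOn.toBasisAt_coe]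
      rfl
    rw [hc]
    have := b.invertibleToMatrix c
    exact (Matrix.isUnit_iff_isUnit_det _).1 (isUnit_of_invertible _)
  have hprod : ContMDiffAt (𝓡 (n + k)) 𝓘(ℝ) ∞ (fun e => ∑ γ, (mat s e)⁻¹ α γ * mat s' e γ β) e₀ :=
    ContMDiffAt.sum fun γ _ =>
      (contMDiffAt_matrix_inv_apply (hsmooth s hs) (hdet e₀ ht hs) α γ).mul (hsmooth s' hs' γ β)
  refine hprod.congr_of_eventuallyEq ?_
  filter_upwards [t.open_baseSet.mem_nhds ht, s.isOpen_domain.mem_nhds hs,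
    s'.isOpen_domain.mem_nhds hs'] with e h1 h2 h3
  rw [← Matrix.mul_apply, hmul e h1 h2 h3, Matrix.nonsing_inv_mul_cancel_left _ _ (hdet e h1 h2)]

/-- The change of the coordinates `ξ` between two local adapted frames. -/
def coordChange (q : E × (Fin k → Fin n → ℝ)) : Fin k → Fin n → ℝ :=
  Matrix.of.symm ((s.transition s' q.1).C * (s.transition s' q.1).A⁻¹ +
    (s.transition s' q.1).B * Matrix.of q.2 * (s.transition s' q.1).A⁻¹)

/-- Each entry of `C A⁻¹ + B ξ A⁻¹` is a polynomial in the entries of `A⁻¹`, `B`, `C` and `ξ`, all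
of which are smooth in `(e, ξ)`. -/
theorem contMDiffAt_coordChange {q : E × (Fin k → Fin n → ℝ)} (hs : q.1 ∈ s.domain)
    (hs' : q.1 ∈ s'.domain) :
    ContMDiffAt ((𝓡 (n + k)).prod 𝓘(ℝ, Fin k → Fin n → ℝ)) 𝓘(ℝ, Fin k → Fin n → ℝ) ∞
      (s.coordChange s') q := by
  have hT (α β : Fin n ⊕ Fin k) :
      ContMDiffAt ((𝓡 (n + k)).prod 𝓘(ℝ, Fin k → Fin n → ℝ)) 𝓘(ℝ) ∞
        (fun r : E × (Fin k → Fin n → ℝ) => (s.transition s' r.1).1.1 α β) q :=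
    (s.contMDiffAt_transition_apply s' hs hs' α β).comp q contMDiffAt_fst
  have hA (i j : Fin n) := contMDiffAt_matrix_inv_apply
    (f := fun r : E × (Fin k → Fin n → ℝ) => (s.transition s' r.1).A)
    (fun i j => hT (Sum.inl i) (Sum.inl j)) (GV.isUnit_det_A _) i j
  have hξ (B : Fin k) (i : Fin n) :
      ContMDiffAt ((𝓡 (n + k)).prod 𝓘(ℝ, Fin k → Fin n → ℝ)) 𝓘(ℝ) ∞
        (fun r : E × (Fin k → Fin n → ℝ) => r.2 B i) q := by
    have h := contMDiffAt_pi_space.1 (contMDiffAt_snd (I := 𝓡 (n + k))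
      (J := 𝓘(ℝ, Fin k → Fin n → ℝ)) (n := ∞) (p := q)) B
    exact contMDiffAt_pi_space.1 h i
  refine contMDiffAt_pi_space.2 fun B => contMDiffAt_pi_space.2 fun i => ?_
  change ContMDiffAt _ _ _ (fun r : E × (Fin k → Fin n → ℝ) =>
    ∑ j, (s.transition s' r.1).C B j * (s.transition s' r.1).A⁻¹ j i +
    ∑ j, (∑ D, (s.transition s' r.1).B B D * r.2 D j) * (s.transition s' r.1).A⁻¹ j i) q
  exact (ContMDiffAt.sum fun j _ => (hT (Sum.inr B) (Sum.inl j)).mul (hA j i)).add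
    (ContMDiffAt.sum fun j _ => (ContMDiffAt.sum fun D _ =>
      (hT (Sum.inr B) (Sum.inr D)).mul (hξ D j)).mul (hA j i))

end LocalAdaptedFrame

/-! ### Bundles over `E` trivialized by local adapted frames. -/

section FrameTrivialization

variable {A : E → Type*} [TopologicalSpace (TotalSpace (Fin k → Fin n → ℝ) A)]

/-- The trivialization `t` is the one attached to the local adapted frame `s`,
`a ↦ (e, c (s e) a)` for `a` in the fibre over `e`. -/
structure IsFrameTrivialization
    (c : ∀ {e : E}, p.AdaptedFrame e → A e ≃ Matrix (Fin k) (Fin n) ℝ)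
    (s : p.LocalAdaptedFrame)
    (t : Bundle.Trivialization (Fin k → Fin n → ℝ) (π (Fin k → Fin n → ℝ) A)) : Prop where
  baseSet_eq : t.baseSet = s.domain
  apply_eq (a : TotalSpace (Fin k → Fin n → ℝ) A) :
    t a = (a.1, Matrix.of.symm (c (s.frameAt a.1) a.2))

variable {c : ∀ {e : E}, p.AdaptedFrame e → A e ≃ Matrix (Fin k) (Fin n) ℝ}
  (hc : ∀ {e : E} (u : p.AdaptedFrame e) (g : GV n k) (a : A e),
    c u a = g.C * g.A⁻¹ + g.B * c (u.act g) a * g.A⁻¹)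

namespace IsFrameTrivialization

variable {s s' : p.LocalAdaptedFrame}
  {t t' : Bundle.Trivialization (Fin k → Fin n → ℝ) (π (Fin k → Fin n → ℝ) A)}
  (ht : IsFrameTrivialization c s t) (ht' : IsFrameTrivialization c s' t')

include hc ht ht' in
-- The transformation law `hc` for the pair `s`, `s'`. No base set hypothesis is needed: outside its
-- domain a local frame takes an arbitrary adapted frame as value, and both the trivialization
-- formula and `transition` are defined with that value.
theorem apply_eq_coordChange (a : TotalSpace (Fin k → Fin n → ℝ) A) :
    t a = (a.1, s.coordChange s' (t' a)) := by
  rw [ht.apply_eq, ht'.apply_eq, LocalAdaptedFrame.coordChange,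
    hc _ (s.transition s' a.1), s.act_transition s']
  rfl

include hc ht ht' in
-- The transition map is `(e, ξ) ↦ (e, coordChange (e, ξ))`, so it inherits the smoothness of the
-- coordinate change on the overlap.
theorem contMDiffAt_apply_symm {q : E × (Fin k → Fin n → ℝ)} (hq : q.1 ∈ t.baseSet)
    (hq' : q.1 ∈ t'.baseSet) :
    ContMDiffAt ((𝓡 (n + k)).prod 𝓘(ℝ, Fin k → Fin n → ℝ))
      ((𝓡 (n + k)).prod 𝓘(ℝ, Fin k → Fin n → ℝ)) ∞
      (fun r => t (t'.toOpenPartialHomeomorph.symm r)) q := by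
  refine (contMDiffAt_fst.prodMk (s.contMDiffAt_coordChange s' (ht.baseSet_eq ▸ hq)
    (ht'.baseSet_eq ▸ hq'))).congr_of_eventuallyEq ?_
  filter_upwards [t'.open_target.mem_nhds (t'.mem_target.2 hq')] with r hr
  rw [apply_eq_coordChange hc ht ht', t'.apply_symm_apply hr, t'.proj_symm_apply hr]

variable [∀ e, TopologicalSpace (A e)] [FiberBundle (Fin k → Fin n → ℝ) A]
  (hA : ∀ t ∈ trivializationAtlas (Fin k → Fin n → ℝ) A, ∃ s : p.LocalAdaptedFrame,
    IsFrameTrivialization c s t)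

include hc hA in
theorem isManifold_totalSpace : IsManifold ((𝓡 (n + k)).prod 𝓘(ℝ, Fin k → Fin n → ℝ)) ∞
    (TotalSpace (Fin k → Fin n → ℝ) A) := by
  refine FiberBundle.isManifold_totalSpace fun t₁ h₁ t₂ h₂ q hq => ?_
  obtain ⟨s₁, hs₁⟩ := hA t₁ h₁
  obtain ⟨s₂, hs₂⟩ := hA t₂ h₂
  have hq₁ : q ∈ t₁.target := hq.1
  have hq₂ : t₁.toOpenPartialHomeomorph.symm q ∈ t₂.source := hq.2
  rw [t₂.mem_source, t₁.proj_symm_apply hq₁] at hq₂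
  exact (contMDiffAt_apply_symm hc hs₂ hs₁ hq₂ (t₁.mem_target.1 hq₁)).contMDiffWithinAt

include hc ht hA in
-- At `a` the preferred trivialization at `a.1` is smooth, since the charts of the total space are
-- made from it; `t` is that trivialization followed by a coordinate change.
theorem contMDiffOn : ContMDiffOn ((𝓡 (n + k)).prod 𝓘(ℝ, Fin k → Fin n → ℝ))
    ((𝓡 (n + k)).prod 𝓘(ℝ, Fin k → Fin n → ℝ)) ∞ t t.source := by
  intro a ha
  obtain ⟨s₁, hs₁⟩ := hA _ (trivialization_mem_atlas (Fin k → Fin n → ℝ) A a.1)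
  have hb : a.1 ∈ (trivializationAt (Fin k → Fin n → ℝ) A a.1).baseSet :=
    FiberBundle.mem_baseSet_trivializationAt' a.1
  have h1 : ContMDiffAt ((𝓡 (n + k)).prod 𝓘(ℝ, Fin k → Fin n → ℝ))
      ((𝓡 (n + k)).prod 𝓘(ℝ, Fin k → Fin n → ℝ)) ∞
      (trivializationAt (Fin k → Fin n → ℝ) A a.1) a := by
    have h := contMDiffAt_totalSpace.1 (contMDiffAt_id
      (I := (𝓡 (n + k)).prod 𝓘(ℝ, Fin k → Fin n → ℝ)) (n := ∞) (x := a))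
    refine (h.1.prodMk h.2).congr_of_eventuallyEq (Filter.Eventually.of_forall fun a' => ?_)
    exact Prod.ext ((congrArg Prod.fst (hs₁.apply_eq a')).trans rfl) rfl
  have h2 := s.contMDiffAt_coordChange s₁
    (q := trivializationAt (Fin k → Fin n → ℝ) A a.1 a)
    (by rw [hs₁.apply_eq]; exact ht.baseSet_eq ▸ t.mem_source.1 ha)
    (by rw [hs₁.apply_eq]; exact hs₁.baseSet_eq ▸ hb)
  exact (((contMDiffAt_proj A).prodMk (h2.comp a h1)).congr_of_eventuallyEq
    (Filter.Eventually.of_forall fun a' =>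
      apply_eq_coordChange hc ht hs₁ a')).contMDiffWithinAt

include hc ht hA in
-- A map into the total space is smooth when its projection and its fibre component in the preferred
-- trivialization are. The projection is `Prod.fst` near `q`, and the fibre component comes from a
-- transition map.
theorem contMDiffOn_symm : ContMDiffOn ((𝓡 (n + k)).prod 𝓘(ℝ, Fin k → Fin n → ℝ))
    ((𝓡 (n + k)).prod 𝓘(ℝ, Fin k → Fin n → ℝ)) ∞
    t.toOpenPartialHomeomorph.symm t.target := by
  intro q hq
  have hp := t.proj_symm_apply hq
  obtain ⟨s₁, hs₁⟩ := hA _ (trivialization_mem_atlas (Fin k → Fin n → ℝ) A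
    (t.toOpenPartialHomeomorph.symm q).1)
  have hb : q.1 ∈ (trivializationAt (Fin k → Fin n → ℝ) A
      (t.toOpenPartialHomeomorph.symm q).1).baseSet := by
    rw [← hp]
    exact FiberBundle.mem_baseSet_trivializationAt' _
  have h := contMDiffAt_apply_symm hc hs₁ ht hb (t.mem_target.1 hq)
  refine ContMDiffAt.contMDiffWithinAt (contMDiffAt_totalSpace.2
    ⟨contMDiffAt_fst.congr_of_eventuallyEq ?_, contMDiffAt_snd.comp q h⟩)
  filter_upwards [t.open_target.mem_nhds hq] with r hr
  exact t.proj_symm_apply hr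

include hc hA in
/-- A bundle over `E` trivialized by the local adapted frames is a smooth affine bundle as soon
as its coordinates with respect to the adapted frames are affine. -/
theorem isSmoothAffineBundle {V : E → Type*} [∀ e, AddCommGroup (V e)] [∀ e, Module ℝ (V e)]
    [∀ e, AddTorsor (V e) (A e)]
    (hα : ∀ {e : E} (u : p.AdaptedFrame e), ∃ α : A e ≃ᵃ[ℝ] (Fin k → Fin n → ℝ),
      ∀ a, α a = Matrix.of.symm (c u a)) :
    IsSmoothAffineBundle (n + k) (Fin k → Fin n → ℝ) V A where
  isManifold := isManifold_totalSpace hc hA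
  exists_trivialization e := by
    obtain ⟨s, hs⟩ := hA _ (trivialization_mem_atlas (Fin k → Fin n → ℝ) A e)
    refine ⟨_, FiberBundle.mem_baseSet_trivializationAt' e, hs.contMDiffOn hc hA,
      hs.contMDiffOn_symm hc hA, fun e' _ => ?_⟩
    obtain ⟨α, h⟩ := hα (s.frameAt e')
    exact ⟨α, fun a => (hs.apply_eq _).trans (by rw [h])⟩

end IsFrameTrivialization

/-! ### Maps between two such bundles. -/

variable {A' : E → Type*} [TopologicalSpace (TotalSpace (Fin k → Fin n → ℝ) A')]
  [∀ e, TopologicalSpace (A e)] [FiberBundle (Fin k → Fin n → ℝ) A]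
  [∀ e, TopologicalSpace (A' e)] [FiberBundle (Fin k → Fin n → ℝ) A']
  {c' : ∀ {e : E}, p.AdaptedFrame e → A' e ≃ Matrix (Fin k) (Fin n) ℝ}

/-- A fibre preserving map which is the identity in the coordinates of every adapted frame is
smooth. -/
theorem contMDiff_of_coord_eq
    (hA : ∀ e : E, ∃ s : p.LocalAdaptedFrame,
      IsFrameTrivialization c s (trivializationAt (Fin k → Fin n → ℝ) A e) ∧
      IsFrameTrivialization c' s (trivializationAt (Fin k → Fin n → ℝ) A' e))
    (f : ∀ e, A e → A' e) (hf : ∀ {e : E} (u : p.AdaptedFrame e) (a : A e), c' u (f e a) = c u a) :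
    ContMDiff ((𝓡 (n + k)).prod 𝓘(ℝ, Fin k → Fin n → ℝ))
      ((𝓡 (n + k)).prod 𝓘(ℝ, Fin k → Fin n → ℝ)) ∞
      (fun a : TotalSpace (Fin k → Fin n → ℝ) A =>
        (⟨a.1, f a.1 a.2⟩ : TotalSpace (Fin k → Fin n → ℝ) A')) := by
  intro a
  obtain ⟨s, hs, hs'⟩ := hA a.1
  have h := contMDiffAt_totalSpace.1 (contMDiffAt_id
    (I := (𝓡 (n + k)).prod 𝓘(ℝ, Fin k → Fin n → ℝ)) (n := ∞) (x := a))
  -- The two preferred trivializations at `a.1` use the same frame `s`, so the fibre component of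
  -- the map is the function `h.2` already known to be smooth.
  refine contMDiffAt_totalSpace.2 ⟨contMDiffAt_proj A,
    h.2.congr_of_eventuallyEq (Filter.Eventually.of_forall fun a' => ?_)⟩
  change (trivializationAt (Fin k → Fin n → ℝ) A' a.1 _).2 =
    (trivializationAt (Fin k → Fin n → ℝ) A a.1 a').2
  rw [hs.apply_eq, hs'.apply_eq, hf]

end FrameTrivialization

/-! ### The two bundles of the theorem and their isomorphism. -/

theorem isFrameTrivialization_associated {t}
    (ht : t ∈ trivializationAtlas (Fin k → Fin n → ℝ) p.AssociatedHomogeneous) :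
    ∃ s : p.LocalAdaptedFrame, IsFrameTrivialization (fun u => Associated.matrixCoord u) s t := by
  obtain ⟨_, ⟨s, rfl⟩, rfl⟩ := ht
  exact ⟨s, rfl, fun _ => rfl⟩

/-- Standard jet coordinates are the coordinates attached to the frame `(∂/∂x^i, ∂/∂y^A)`, so the
jet atlas uses only coordinate frames, while the atlas of the associated bundle uses all smooth
local adapted frames. -/
theorem isFrameTrivialization_jet {t} (ht : t ∈ trivializationAtlas (Fin k → Fin n → ℝ) p.Jet) :
    ∃ s : p.LocalAdaptedFrame, IsFrameTrivialization (fun u => Jet.matrixCoord u) s t := by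
  obtain ⟨_, ⟨c, rfl⟩, rfl⟩ := ht
  exact ⟨c.frame, rfl, fun _ => rfl⟩

/-- Although the two atlases differ, the preferred trivializations at `e` come from one and the same
adapted chart. This is what makes the isomorphism the identity in coordinates. -/
theorem isFrameTrivialization_trivializationAt (e : E) :
    IsFrameTrivialization (fun u => Associated.matrixCoord u) (p.adaptedChartAt e).frame
      (trivializationAt (Fin k → Fin n → ℝ) p.AssociatedHomogeneous e) ∧
    IsFrameTrivialization (fun u => Jet.matrixCoord u) (p.adaptedChartAt e).frame
      (trivializationAt (Fin k → Fin n → ℝ) p.Jet e) :=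
  ⟨⟨rfl, fun _ => rfl⟩, ⟨rfl, fun _ => rfl⟩⟩

variable (p) in
/-- The isomorphism `L_π E ×_{G_V} (G_V / H) ≅ J¹π` of smooth affine bundles. -/
def jetBundleEquiv : SmoothAffineBundleEquiv (n + k) (Fin k → Fin n → ℝ)
    (fun e : E => p.AssociatedDirection e) (fun e : E => p.AssociatedHomogeneous e)
    (fun e : E => p.JetDirection e) (fun e : E => p.Jet e) where
  fiberEquiv := p.jetEquiv
  contMDiff_toFun := contMDiff_of_coord_eq
    (fun e => ⟨_, p.isFrameTrivialization_trivializationAt e⟩) (fun e => p.jetEquiv e)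
    matrixCoord_jetEquiv
  contMDiff_invFun := contMDiff_of_coord_eq
    (fun e => ⟨_, (p.isFrameTrivialization_trivializationAt e).symm⟩) (fun e => (p.jetEquiv e).symm)
    fun u a => by rw [← matrixCoord_jetEquiv, AffineEquiv.apply_symm_apply]

end SmoothFiberBundle

end

/-! ### The theorem. -/

theorem mainTheorem1 {n k : ℕ} {M E F : Type*}
    [TopologicalSpace M] [ChartedSpace (EuclideanSpace ℝ (Fin n)) M] [IsManifold (𝓡 n) ∞ M]
    [TopologicalSpace E] [ChartedSpace (EuclideanSpace ℝ (Fin (n + k))) E]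
    [IsManifold (𝓡 (n + k)) ∞ E]
    [TopologicalSpace F] [ChartedSpace (EuclideanSpace ℝ (Fin k)) F] [IsManifold (𝓡 k) ∞ F]
    (p : SmoothFiberBundle n k M E F) :
    IsSmoothAffineBundle (n + k) (Fin k → Fin n → ℝ)
      (fun e : E => p.AssociatedDirection e) (fun e : E => p.AssociatedHomogeneous e) ∧
    IsSmoothAffineBundle (n + k) (Fin k → Fin n → ℝ)
      (fun e : E => p.JetDirection e) (fun e : E => p.Jet e) ∧
    ∃ Φ : SmoothAffineBundleEquiv (n + k) (Fin k → Fin n → ℝ)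
        (fun e : E => p.AssociatedDirection e) (fun e : E => p.AssociatedHomogeneous e)
        (fun e : E => p.JetDirection e) (fun e : E => p.Jet e),
      ∀ (e : E) (u : p.AdaptedFrame e) (ξ : Matrix (Fin k) (Fin n) ℝ) (i : Fin n),
        (Φ.fiberEquiv e
            (SmoothFiberBundle.Associated.mk u (GV.unip ξ : HomogeneousSpace n k))).toLin
          (p.tangentMapAt e (u.basis (Sum.inl i))) =
        u.basis (Sum.inl i) + ∑ A, ξ A i • u.basis (Sum.inr A) := by
  refine ⟨SmoothFiberBundle.IsFrameTrivialization.isSmoothAffineBundle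
      (fun u g a => SmoothFiberBundle.Associated.matrixCoord_act u g a)
      (fun _ => p.isFrameTrivialization_associated)
      fun u => ⟨SmoothFiberBundle.Associated.affineCoord u, fun _ => rfl⟩,
    SmoothFiberBundle.IsFrameTrivialization.isSmoothAffineBundle
      (fun u g a => SmoothFiberBundle.Jet.matrixCoord_act u g a)
      (fun _ => p.isFrameTrivialization_jet)
      fun u => ⟨SmoothFiberBundle.Jet.affineCoord u, fun _ => rfl⟩,
    p.jetBundleEquiv, fun e u ξ i => ?_⟩
  -- The value of a jet on `π_* e_i` can be read off from its coordinate matrix in the frame `u`, so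
  -- it suffices that this matrix is `ξ`; it equals the coordinate of `[u, ξ]` in the same frame.
  have h : SmoothFiberBundle.Jet.matrixCoord u (p.jetBundleEquiv.fiberEquiv e
      (SmoothFiberBundle.Associated.mk u (GV.unip ξ : HomogeneousSpace n k))) = ξ := by
    refine (SmoothFiberBundle.matrixCoord_jetEquiv u _).trans ?_
    change HomogeneousSpace.coord n k (SmoothFiberBundle.Associated.coord u _) = ξ
    rw [SmoothFiberBundle.Associated.coord_mk]
    exact (HomogeneousSpace.coord n k).apply_symm_apply ξ
  rw [SmoothFiberBundle.Jet.apply_eq, h]
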